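/- Let $0<p<1$ and $q=1-p$. Let $X_1,X_2,\dots$ be i.i.d. random variables, uniform on $[0,1]$, and let $N$ be independent of them with $P(N=k)=pq^{k-1}$, $k\ge 1$. The objects with values $X_1,\dots,X_N$ appear one after another; at time $n$ the values $X_1,\dots,X_n$ and the events $\{N\ge 1\},\dots,\{N\ge n\}$ are known. The $n$-th object ($n\le N$) is a relative maximum if $X_n=\max\{X_1,\dots,X_n\}$. Let $T_n$ be the smallest $m\ge n$ such that $m=N$ or the $n$-th object is neither the best nor the second best among the objects $1,\dots,m$. A stopping time $\tau$ with values in $\{1,2,\dots\}\cup\{\infty\}$ is admissible if on $\{\tau=n\}$ one has $n\le N$ and the $n$-th object is a relative maximum; its reward is $T_\tau-\tau$, and $0$ if $\tau=\infty$. The aim is to maximize the expected reward over all admissible $\tau$. (1) The conditional expected reward of stopping at time $n\le N$ at a relative maximum of value $X_n=x$, given the information at time $n$, is almost surely $$w(x)=\frac{2q}{1-qx}-\frac{q(1-q)}{(1-qx)^2},$$ and that of passing over it and stopping at the next relative maximum (with reward $0$ if there is none) is $$Tw(x)=\sum_{m>n}q^{m-n}x^{m-n-1}\int_x^1 w(v)\,dv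 .$$ (2) The one-step-look-ahead rule, which stops at the first relative maximum whose value lies in $B=\{x\in[0,1]: w(x)\ge Tw(x)\}$, is admissible and optimal. (3) The equation $\mu^2e^{2/\mu}=e^3$ has exactly one solution $\mu^*>1$, and $|\mu^*-3.3145|<10^{-4}$. For every $p$, $$B=\Big\{x\in[0,1]:x\ge \frac{\mu^*p-1}{p-1}\Big\},$$ so that the one-step-look-ahead rule is, almost surely, the rule that stops at the first relative maximum of value at least $(\mu^*p-1)/(p-1)$. This threshold lies in $(0,1)$ if $p<1/\mu^*$. If $p\ge 1/\mu^*$, it is at most $0$ and the rule almost surely stops at the very first object. -/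

import Mathlib

open MeasureTheory ProbabilityTheory

noncomputable section

namespace GeomDuration

/-! Objects are numbered `1, 2, 3, …`; `X k` is the value of the `k`-th object and `N` is the random
number of objects that actually appear.  The entry `X 0` is never used. -/

/-- The object observed at time `n` is a relative maximum. -/
def IsRelMax {Ω : Type*} (X : ℕ → Ω → ℝ) (n : ℕ) (ω : Ω) : Prop :=
  ∀ j, 1 ≤ j → j ≤ n → X j ω ≤ X n ω

/-- The relative rank of the `n`-th object among the objects `1, …, m` (rank `1` is the best). -/
def relRank {Ω : Type*} (X : ℕ → Ω → ℝ) (n m : ℕ) (ω : Ω) : ℕ :=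
  1 + ((Finset.Icc 1 m).filter (fun j => X n ω < X j ω)).card

/-- The maturity of the `n`-th object: the first time `m ≥ n` at which it is no longer relatively
best or second best, or at which the horizon `N` is reached. -/
def maturity {Ω : Type*} (X : ℕ → Ω → ℝ) (N : Ω → ℕ) (n : ℕ) (ω : Ω) : ℕ :=
  sInf {m | n ≤ m ∧ (2 < relRank X n m ω ∨ m = N ω)}

open Classical in
/-- The duration collected by selecting the `n`-th object (zero if that object never appears). -/
def duration {Ω : Type*} (X : ℕ → Ω → ℝ) (N : Ω → ℕ) (n : ℕ) (ω : Ω) : ℝ :=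
  if n ≤ N ω then (maturity X N n ω : ℝ) - (n : ℝ) else 0

open Classical in
/-- The duration collected by a stopping rule; the value `⊤` means that nothing is selected. -/
def reward {Ω : Type*} (X : ℕ → Ω → ℝ) (N : Ω → ℕ) (τ : Ω → WithTop ℕ) (ω : Ω) : ℝ :=
  if τ ω = ⊤ then 0 else duration X N ((τ ω).untopD 0) ω

/-- The information at time `n`: the values `X 1, …, X n` and the events `{1 ≤ N}, …, {n ≤ N}`. -/
def info {Ω : Type*} [mΩ : MeasurableSpace Ω] (X : ℕ → Ω → ℝ) (N : Ω → ℕ)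
    (hX : ∀ k, 1 ≤ k → Measurable (X k)) (hN : Measurable N) : Filtration ℕ mΩ where
  seq n := ⨆ k ∈ Set.Icc 1 n,
    (MeasurableSpace.comap (X k) inferInstance ⊔ MeasurableSpace.comap (fun ω => k ≤ N ω) ⊤)
  mono' := fun _ _ h => biSup_mono fun _ hk => ⟨hk.1, hk.2.trans h⟩
  le' := fun _ => iSup₂_le fun k hk => sup_le (hX k hk.1).comap_le
    (Measurable.comap_le (measurableSet_setOfPred.1 (measurableSet_le measurable_const hN)))

/-- The admissible stopping rules: stopping times that stop only at relative maxima among the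
objects that appear. -/
def Admissible {Ω : Type*} [mΩ : MeasurableSpace Ω] (X : ℕ → Ω → ℝ) (N : Ω → ℕ)
    (hX : ∀ k, 1 ≤ k → Measurable (X k)) (hN : Measurable N) (τ : Ω → WithTop ℕ) : Prop :=
  IsStoppingTime (info X N hX hN) τ ∧
    ∀ ω (n : ℕ), τ ω = (n : WithTop ℕ) → 1 ≤ n ∧ n ≤ N ω ∧ IsRelMax X n ω

open Classical in
/-- The first time after `n` at which a relative maximum appears (`⊤` if there is none). -/
def nextRelMax {Ω : Type*} (X : ℕ → Ω → ℝ) (N : Ω → ℕ) (n : ℕ) (ω : Ω) : WithTop ℕ :=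
  if h : ∃ m : ℕ, n < m ∧ m ≤ N ω ∧ IsRelMax X m ω then ((Nat.find h : ℕ) : WithTop ℕ) else ⊤

open Classical in
/-- The rule that stops at the first relative maximum with value in `S`
(`⊤` if there is none). -/
def firstRelMaxIn {Ω : Type*} (X : ℕ → Ω → ℝ) (N : Ω → ℕ) (S : Set ℝ) (ω : Ω) : WithTop ℕ :=
  if h : ∃ m : ℕ, 1 ≤ m ∧ m ≤ N ω ∧ IsRelMax X m ω ∧ X m ω ∈ S then
    ((Nat.find h : ℕ) : WithTop ℕ) else ⊤

/-- The payoff `w(x)` for stopping at a relative maximum of value `x`, with `q = 1 - p`. -/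
def payoff (p x : ℝ) : ℝ :=
  2 * (1 - p) / (1 - (1 - p) * x) - (1 - p) * p / (1 - (1 - p) * x) ^ 2

/-- The payoff `Tw(x)` for passing over a relative maximum of value `x` and stopping at the next one;
it comes `k + 1` steps later with a value in `dv` with probability `q ^ (k + 1) x ^ k dv`. -/
def nextPayoff (p x : ℝ) : ℝ :=
  ∑' k : ℕ, ∫ v in x..1, payoff p v * ((1 - p) ^ (k + 1) * x ^ k)

/-- The stopping set of the one-step-look-ahead rule. -/
def lookAheadSet (p : ℝ) : Set ℝ :=
  {x | x ∈ Set.Icc (0 : ℝ) 1 ∧ nextPayoff p x ≤ payoff p x}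

/-- The threshold, as a function of the constant `c = μ*` and of `p`. -/
def threshold (c p : ℝ) : ℝ := (c * p - 1) / (p - 1)

end GeomDuration

end

namespace GeomDuration

open Set
open scoped ENNReal

/-! ### The equation for the threshold constant -/

/-! Write `q = 1 - p`. The horizon is memoryless: given that object `n` appears, the next one
appears with probability `q`, and its value is uniform and independent of the past
(`lintegral_step`). A duration counts the `k ≥ 0` for which the object has rank at most two at time
`n + k` and one more object appears. For a relative maximum of value `x`, rank one at `n + k` has
weight `(qx)^k` and rank two has weight `k (qx)^(k-1) q(1-x)`. Summing gives `w`
(`lintegral_duration`). The same bookkeeping, with later values below `x` until one reaches `x`,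
gives `Tw(x) = q/(1-qx) ∫_x^1 w` (`lintegral_reward_nextRelMax`). In terms of `u = (1-qx)/p ≥ 1`,
the inequality `Tw ≤ w` reads `log u + 1/u ≤ 3/2` (`nextPayoff_le_payoff_iff`). The left side
increases on `[1,∞)`, so `B` is an upper interval, cut off at the same `u = μ*` for every `p`.
Optimality is a verification argument. With `s` the threshold truncated at `0`, the candidate value
of continuing from running maximum `m` is `V(m) = Tw(max m s)`. It solves `V(m) = q (m V(m) + ∫_m^1
max(w, V))` (`contValue_fixed`). Hence the payoff collected up to time `n` plus `V` on what remains
(`gain`) never increases for an admissible rule (`gain_succ_le`) and is constant for the look-ahead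
rule (`gain_succ_eq`). The remainder dies out geometrically because the process must still be
running (`le_lintegral_reward`). Integrals of nonnegative functions are kept in `ℝ≥0∞`, so
integrability of every reward follows from the upper bound. -/

theorem strictMonoOn_log_add_inv : StrictMonoOn (fun t : ℝ => Real.log t + 1 / t) (Ici 1) := by
  have hd : ∀ x : ℝ, 0 < x →
      HasDerivAt (fun t : ℝ => Real.log t + 1 / t) (x⁻¹ + -(x ^ 2)⁻¹) x := fun x hx => by
    simp only [one_div]
    exact (Real.hasDerivAt_log hx.ne').add (hasDerivAt_inv hx.ne')
  refine strictMonoOn_of_deriv_pos (convex_Ici 1) (fun x hx => ?_) fun x hx => ?_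
  · exact (hd x (one_pos.trans_le hx)).continuousAt.continuousWithinAt
  · rw [interior_Ici, mem_Ioi] at hx
    rw [(hd x (one_pos.trans hx)).deriv]
    have : (x ^ 2)⁻¹ < x⁻¹ := inv_strictAnti₀ (by linarith) (by nlinarith)
    linarith

/-- Half the logarithm of the equation; in this form the constant is a level point of an increasing
function. -/
theorem sq_mul_exp_eq_iff {c : ℝ} (hc : 0 < c) :
    c ^ 2 * Real.exp (2 / c) = Real.exp 3 ↔ Real.log c + 1 / c = 3 / 2 := by
  have h : c ^ 2 * Real.exp (2 / c) = Real.exp (2 * (Real.log c + 1 / c)) := by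
    rw [mul_add, Real.exp_add, mul_one_div, two_mul, Real.exp_add, Real.exp_log hc, sq]
  rw [h, Real.exp_eq_exp]
  constructor <;> intro h <;> linarith

/-- With `t = (y-3)/(y+3)` one has `y = 3 (1+t)/(1-t)`. The logarithm of `y` is therefore `log 3`,
known to ten digits, plus a rapidly convergent odd series at `t ≈ 0.05`, for which three terms
suffice. -/
theorem log_add_inv_lower : Real.log 3.3144 + 1 / 3.3144 < (3 / 2 : ℝ) := by
  have h3 := (abs_le.1 Real.log_three_near_10).2
  have h := Real.log_div_le_sum_range_add (x := 0.3144 / 6.3144) (by norm_num) (by norm_num) 3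
  have e : (3.3144 : ℝ) = 3 * ((1 + 0.3144 / 6.3144) / (1 - 0.3144 / 6.3144)) := by norm_num
  have hl : Real.log 3.3144 =
      Real.log 3 + Real.log ((1 + 0.3144 / 6.3144) / (1 - 0.3144 / 6.3144)) := by
    rw [← Real.log_mul (by norm_num) (by norm_num), ← e]
  rw [hl]
  norm_num [Finset.sum_range_succ] at h h3 ⊢
  linarith

theorem log_add_inv_upper : (3 / 2 : ℝ) < Real.log 3.3146 + 1 / 3.3146 := by
  have h3 := (abs_le.1 Real.log_three_near_10).1
  have h := Real.sum_range_le_log_div (x := 0.3146 / 6.3146) (by norm_num) (by norm_num) 3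
  have e : (3.3146 : ℝ) = 3 * ((1 + 0.3146 / 6.3146) / (1 - 0.3146 / 6.3146)) := by norm_num
  have hl : Real.log 3.3146 =
      Real.log 3 + Real.log ((1 + 0.3146 / 6.3146) / (1 - 0.3146 / 6.3146)) := by
    rw [← Real.log_mul (by norm_num) (by norm_num), ← e]
  rw [hl]
  norm_num [Finset.sum_range_succ] at h h3 ⊢
  linarith

theorem abs_sub_lt_of_log_add_inv {c : ℝ} (hc : 1 < c) (h : Real.log c + 1 / c = 3 / 2) :
    |c - 3.3145| < 0.0001 := by
  have h1 : (3.3144 : ℝ) < c := (strictMonoOn_log_add_inv.lt_iff_lt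
    (a := 3.3144) (b := c) (by norm_num [mem_Ici]) (mem_Ici.2 hc.le)).1
    (by simpa only [h] using log_add_inv_lower)
  have h2 : c < (3.3146 : ℝ) := (strictMonoOn_log_add_inv.lt_iff_lt
    (a := c) (b := 3.3146) (mem_Ici.2 hc.le) (by norm_num [mem_Ici])).1
    (by simpa only [h] using log_add_inv_upper)
  rw [abs_lt]
  constructor <;> norm_num at h1 h2 ⊢ <;> linarith

theorem existsUnique_sq_mul_exp :
    ∃! c : ℝ, 1 < c ∧ c ^ 2 * Real.exp (2 / c) = Real.exp 3 := by
  have hcont : ContinuousOn (fun t : ℝ => Real.log t + 1 / t) (Icc 3.3144 3.3146) := by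
    refine ContinuousOn.add (Real.continuousOn_log.mono fun x hx => ?_)
      (continuousOn_const.div continuousOn_id fun x hx => ?_)
    all_goals
      have := hx.1
      norm_num at this
      have : (0 : ℝ) < x := by linarith
      simpa using this.ne'
  obtain ⟨c, hc, hc'⟩ := intermediate_value_Icc (by norm_num) hcont
    ⟨log_add_inv_lower.le, log_add_inv_upper.le⟩
  have h1 : 1 < c := lt_of_lt_of_le (by norm_num) hc.1
  refine ⟨c, ⟨h1, (sq_mul_exp_eq_iff (by linarith)).2 hc'⟩, fun d ⟨hd1, hd⟩ => ?_⟩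
  rw [sq_mul_exp_eq_iff (by linarith)] at hd
  exact strictMonoOn_log_add_inv.injOn (mem_Ici.2 hd1.le) (mem_Ici.2 h1.le) (hd.trans hc'.symm)

/-! ### The payoff functions -/

section Payoff

variable {p : ℝ}

theorem le_denom (hp1 : p < 1) {x : ℝ} (hx : x ≤ 1) : p ≤ 1 - (1 - p) * x := by
  nlinarith

theorem payoff_eq (x : ℝ) : payoff p x = (1 - p) *
    (2 * (1 / (1 - (1 - p) * x)) - p * (1 / (1 - (1 - p) * x)) ^ 2) := by
  rw [payoff, one_div_pow]
  ring

/-- In `a = 1/(1-qx)` the payoff is the parabola `q(2a - pa²)`, which increases up to `a = 1/p`; `x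
≤ 1` keeps `a` below that point. -/
theorem payoff_monotoneOn (hp0 : 0 < p) (hp1 : p < 1) : MonotoneOn (payoff p) (Iic 1) := by
  intro x hx y hy hxy
  have hdx := le_denom hp1 (mem_Iic.1 hx)
  have hdy := le_denom hp1 (mem_Iic.1 hy)
  rw [payoff_eq, payoff_eq]
  set a := 1 / (1 - (1 - p) * x) with ha
  set b := 1 / (1 - (1 - p) * y) with hb
  have hab : a ≤ b := one_div_le_one_div_of_le (by linarith) (by nlinarith)
  have ha1 : p * a ≤ 1 := by rw [ha, mul_one_div, div_le_one (by linarith)]; exact hdx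
  have hb1 : p * b ≤ 1 := by rw [hb, mul_one_div, div_le_one (by linarith)]; exact hdy
  refine mul_le_mul_of_nonneg_left ?_ (by linarith)
  nlinarith [mul_nonneg (sub_nonneg.2 hab) (by linarith : 0 ≤ 2 - p * (a + b))]

theorem payoff_nonneg (hp0 : 0 < p) (hp1 : p < 1) {x : ℝ} (hx : x ≤ 1) : 0 ≤ payoff p x := by
  have hd := le_denom hp1 hx
  rw [payoff_eq]
  set a := 1 / (1 - (1 - p) * x) with ha
  have ha0 : 0 ≤ a := one_div_nonneg.2 (by linarith)
  have ha1 : p * a ≤ 1 := by rw [ha, mul_one_div, div_le_one (by linarith)]; exact hd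
  exact mul_nonneg (by linarith) (by nlinarith)

theorem measurable_payoff : Measurable (payoff p) := by
  unfold payoff
  fun_prop

theorem continuousOn_payoff (hp0 : 0 < p) (hp1 : p < 1) : ContinuousOn (payoff p) (Iic 1) := by
  have hd : ∀ x ∈ Iic (1 : ℝ), 1 - (1 - p) * x ≠ 0 := fun x hx =>
    (hp0.trans_le (le_denom hp1 hx)).ne'
  unfold payoff
  refine ContinuousOn.sub (ContinuousOn.div (by fun_prop) (by fun_prop) hd)
    (ContinuousOn.div (by fun_prop) (by fun_prop) fun x hx => pow_ne_zero 2 (hd x hx))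

theorem intervalIntegrable_payoff (hp0 : 0 < p) (hp1 : p < 1) {x y : ℝ} (hx : x ≤ 1)
    (hy : y ≤ 1) : IntervalIntegrable (payoff p) volume x y :=
  ((continuousOn_payoff hp0 hp1).mono fun _ hz => hz.2.trans (max_le hx hy)).intervalIntegrable

theorem integral_payoff (hp0 : 0 < p) (hp1 : p < 1) {x : ℝ} (hx : x ≤ 1) :
    ∫ v in x..1, payoff p v =
      2 * Real.log ((1 - (1 - p) * x) / p) + p / (1 - (1 - p) * x) - 1 := by
  have hd : ∀ y ≤ (1 : ℝ), 1 - (1 - p) * y ≠ 0 := fun y hy =>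
    (hp0.trans_le (le_denom hp1 hy)).ne'
  have hderiv : ∀ y ∈ uIcc x 1, HasDerivAt
      (fun y => -2 * Real.log (1 - (1 - p) * y) - p * (1 - (1 - p) * y)⁻¹) (payoff p y) y := by
    intro y hy
    have hy1 : y ≤ 1 := hy.2.trans (max_le hx le_rfl)
    have h1 : HasDerivAt (fun y : ℝ => 1 - (1 - p) * y) (-(1 - p)) y := by
      simpa using ((hasDerivAt_id y).const_mul (1 - p)).const_sub 1
    refine (((h1.log (hd y hy1)).const_mul (-2)).sub
      ((h1.inv (hd y hy1)).const_mul p)).congr_deriv ?_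
    have := hd y hy1
    rw [payoff]
    field_simp
  rw [intervalIntegral.integral_eq_sub_of_hasDerivAt hderiv
    (intervalIntegrable_payoff hp0 hp1 hx le_rfl), Real.log_div (hd x hx) hp0.ne']
  have e : 1 - (1 - p) * 1 = p := by ring
  simp only [e, mul_inv_cancel₀ hp0.ne']
  ring

/-- Delay and value of the next maximum factorize, and the delay contributes a geometric series of
ratio `(1-p)x`. -/
theorem nextPayoff_eq_mul_integral (hp0 : 0 < p) (hp1 : p < 1) {x : ℝ} (hx0 : 0 ≤ x)
    (hx : x ≤ 1) :
    nextPayoff p x = (1 - p) / (1 - (1 - p) * x) * ∫ v in x..1, payoff p v := by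
  have hq : ∀ k : ℕ, ∫ v in x..1, payoff p v * ((1 - p) ^ (k + 1) * x ^ k) =
      ((1 - p) * ∫ v in x..1, payoff p v) * ((1 - p) * x) ^ k := fun k => by
    rw [intervalIntegral.integral_mul_const, mul_pow]
    ring
  simp only [nextPayoff, hq]
  rw [tsum_mul_left, tsum_geometric_of_lt_one (by nlinarith) (by nlinarith)]
  ring

/-- A closed form of `nextPayoff` on `[0, 1]`. -/
noncomputable def nextPayoffClosed (p x : ℝ) : ℝ :=
  (1 - p) / (1 - (1 - p) * x) *
    (2 * Real.log ((1 - (1 - p) * x) / p) + p / (1 - (1 - p) * x) - 1)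

theorem measurable_nextPayoffClosed : Measurable (nextPayoffClosed p) := by
  unfold nextPayoffClosed
  fun_prop

theorem nextPayoff_eq_closed (hp0 : 0 < p) (hp1 : p < 1) {x : ℝ} (hx0 : 0 ≤ x) (hx : x ≤ 1) :
    nextPayoff p x = nextPayoffClosed p x := by
  rw [nextPayoff_eq_mul_integral hp0 hp1 hx0 hx, integral_payoff hp0 hp1 hx, nextPayoffClosed]

theorem integral_payoff_nonneg (hp0 : 0 < p) (hp1 : p < 1) {x : ℝ} (hx : x ≤ 1) :
    0 ≤ ∫ v in x..1, payoff p v :=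
  intervalIntegral.integral_nonneg hx fun _ hv => payoff_nonneg hp0 hp1 hv.2

theorem nextPayoff_nonneg (hp0 : 0 < p) (hp1 : p < 1) {x : ℝ} (hx0 : 0 ≤ x) (hx : x ≤ 1) :
    0 ≤ nextPayoff p x := by
  rw [nextPayoff_eq_mul_integral hp0 hp1 hx0 hx]
  exact mul_nonneg (div_nonneg (by linarith) (hp0.le.trans (le_denom hp1 hx)))
    (integral_payoff_nonneg hp0 hp1 hx)

/-- Both payoffs carry the positive factor `q/(1-qx)`. Cancelling it leaves `2 log u + 1/u - 1 ≤ 2 -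
1/u` with `u = (1-qx)/p`, where `p` no longer occurs separately. -/
theorem nextPayoff_le_payoff_iff (hp0 : 0 < p) (hp1 : p < 1) {x : ℝ} (hx0 : 0 ≤ x)
    (hx : x ≤ 1) : nextPayoff p x ≤ payoff p x ↔
      Real.log ((1 - (1 - p) * x) / p) + 1 / ((1 - (1 - p) * x) / p) ≤ 3 / 2 := by
  have hd := hp0.trans_le (le_denom hp1 hx)
  rw [nextPayoff_eq_closed hp0 hp1 hx0 hx, nextPayoffClosed]
  have e : payoff p x = (1 - p) / (1 - (1 - p) * x) * (2 - p / (1 - (1 - p) * x)) := by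
    rw [payoff]
    field_simp
  rw [e, mul_le_mul_iff_right₀ (div_pos (by linarith) hd), one_div_div]
  constructor <;> intro h <;> linarith

variable {c : ℝ}

theorem threshold_le_iff (hp1 : p < 1) {x : ℝ} :
    threshold c p ≤ x ↔ 1 - (1 - p) * x ≤ c * p := by
  rw [threshold, div_le_iff_of_neg (by linarith)]
  constructor <;> intro h <;> linarith

theorem nextPayoff_le_payoff_iff_threshold_le (hp0 : 0 < p) (hp1 : p < 1) (hc : 1 < c)
    (h : Real.log c + 1 / c = 3 / 2) {x : ℝ} (hx0 : 0 ≤ x) (hx : x ≤ 1) :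
    nextPayoff p x ≤ payoff p x ↔ threshold c p ≤ x := by
  rw [nextPayoff_le_payoff_iff hp0 hp1 hx0 hx, ← h, threshold_le_iff hp1, ← div_le_iff₀ hp0]
  exact strictMonoOn_log_add_inv.le_iff_le (mem_Ici.2 ((one_le_div hp0).2 (le_denom hp1 hx)))
    (mem_Ici.2 hc.le)

theorem lookAheadSet_eq (hp0 : 0 < p) (hp1 : p < 1) (hc : 1 < c)
    (h : Real.log c + 1 / c = 3 / 2) :
    lookAheadSet p = Icc (0 : ℝ) 1 ∩ Ici (threshold c p) := by
  ext x
  exact and_congr_right fun hx => nextPayoff_le_payoff_iff_threshold_le hp0 hp1 hc h hx.1 hx.2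

theorem threshold_lt_one (hp0 : 0 < p) (hp1 : p < 1) (hc : 1 < c) : threshold c p < 1 := by
  rw [threshold, div_lt_iff_of_neg (by linarith)]
  nlinarith

theorem threshold_pos (hp1 : p < 1) (hc : 1 < c) (h : p < 1 / c) : 0 < threshold c p := by
  rw [lt_div_iff₀ (by linarith)] at h
  exact div_pos_of_neg_of_neg (by linarith) (by linarith)

theorem threshold_nonpos (hp1 : p < 1) (hc : 1 < c) (h : 1 / c ≤ p) : threshold c p ≤ 0 := by
  rw [div_le_iff₀ (by linarith)] at h
  exact div_nonpos_of_nonneg_of_nonpos (by linarith) (by linarith)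

/-! ### The value function -/

/-- The value of continuing when the best value so far is `x`, for a rule that stops at the first
relative maximum of value at least `s`. -/
noncomputable def contValue (p s x : ℝ) : ℝ := nextPayoffClosed p (max x s)

theorem measurable_contValue {s : ℝ} : Measurable (contValue p s) :=
  measurable_nextPayoffClosed.comp (measurable_id.max measurable_const)

theorem contValue_nonneg (hp0 : 0 < p) (hp1 : p < 1) {s x : ℝ} (hs0 : 0 ≤ s) (hs1 : s ≤ 1)
    (hx : x ≤ 1) : 0 ≤ contValue p s x := by
  have h0 : 0 ≤ max x s := hs0.trans (le_max_right _ _)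
  have h1 : max x s ≤ 1 := max_le hx hs1
  rw [contValue, ← nextPayoff_eq_closed hp0 hp1 h0 h1]
  exact nextPayoff_nonneg hp0 hp1 h0 h1

/-- The best of stopping at a relative maximum `v` and continuing from there. -/
noncomputable def stopValue (p s v : ℝ) : ℝ := max (payoff p v) (contValue p s v)

theorem measurable_stopValue {s : ℝ} : Measurable (stopValue p s) :=
  measurable_payoff.max measurable_contValue

/-- The look-ahead rule is the threshold rule with threshold `s`. -/
structure IsThreshold (p s : ℝ) : Prop where
  nonneg : 0 ≤ s
  lt_one : s < 1
  lookAheadSet_eq : lookAheadSet p = Icc 0 1 ∩ Ici s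
  payoff_le : ∀ x, 0 ≤ x → x < s → payoff p x ≤ nextPayoff p s

/-- For `payoff_le`, if the threshold is positive then `w(x) ≤ w(s) = Tw(s)` by monotonicity of `w`;
otherwise `s = 0` and no `x` qualifies. -/
theorem isThreshold (hp0 : 0 < p) (hp1 : p < 1) (hc : 1 < c)
    (h : Real.log c + 1 / c = 3 / 2) : IsThreshold p (max (threshold c p) 0) where
  nonneg := le_max_right _ _
  lt_one := max_lt (threshold_lt_one hp0 hp1 hc) one_pos
  lookAheadSet_eq := by
    rw [GeomDuration.lookAheadSet_eq hp0 hp1 hc h]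
    ext x
    simp only [mem_inter_iff, mem_Icc, mem_Ici, max_le_iff]
    tauto
  payoff_le x hx0 hx := by
    have hpos : 0 < threshold c p := by
      by_contra! hneg
      rw [max_eq_right hneg] at hx
      linarith
    rw [max_eq_left hpos.le] at hx ⊢
    have hlt := threshold_lt_one hp0 hp1 hc
    have hs : payoff p (threshold c p) ≤ nextPayoff p (threshold c p) := by
      have e : (1 - (1 - p) * threshold c p) / p = c := by
        have : p - 1 ≠ 0 := by linarith
        rw [threshold]
        field_simp
        ring
      have hd := hp0.trans_le (le_denom hp1 hlt.le)
      -- Here `u = c`, and the defining equation of `c` makes stopping and waiting equally good.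
      have e1 : nextPayoff p (threshold c p) = payoff p (threshold c p) := by
        have e2 : 1 - (1 - p) * threshold c p = c * p := by rw [← div_eq_iff hp0.ne', e]
        have hcp : c * p ≠ 0 := by positivity
        have hc0 : c ≠ 0 := by linarith
        rw [nextPayoff_eq_closed hp0 hp1 hpos.le hlt.le, nextPayoffClosed, e, e2, payoff, e2,
          show Real.log c = 3 / 2 - 1 / c by linarith]
        field_simp
        ring
      exact e1.ge
    exact (payoff_monotoneOn hp0 hp1 (mem_Iic.2 (hx.le.trans hlt.le)) (mem_Iic.2 hlt.le)
      hx.le).trans hs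

variable {s : ℝ}

theorem IsThreshold.le_payoff (hs : IsThreshold p s) {x : ℝ} (hx : s ≤ x) (hx1 : x ≤ 1) :
    nextPayoff p x ≤ payoff p x :=
  (hs.lookAheadSet_eq.ge ⟨⟨hs.nonneg.trans hx, hx1⟩, hx⟩).2

theorem stopValue_of_le (hp0 : 0 < p) (hp1 : p < 1) (hs : IsThreshold p s) {v : ℝ}
    (hv : s ≤ v) (hv1 : v ≤ 1) : stopValue p s v = payoff p v := by
  rw [stopValue, contValue, max_eq_left hv, ← nextPayoff_eq_closed hp0 hp1 (hs.nonneg.trans hv) hv1,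
    max_eq_left (hs.le_payoff hv hv1)]

/-- Below `s` continuing wins, and its value does not depend on `v`: the next accepted value is at
least `s` in any case. -/
theorem stopValue_of_lt (hp0 : 0 < p) (hp1 : p < 1) (hs : IsThreshold p s) {v : ℝ}
    (hv : v < s) (hv0 : 0 ≤ v) : stopValue p s v = contValue p s s := by
  rw [stopValue, contValue, max_eq_right hv.le, contValue, max_self,
    ← nextPayoff_eq_closed hp0 hp1 hs.nonneg hs.lt_one.le, max_eq_right (hs.payoff_le v hv0 hv)]

/-- The geometric series unrolled once: the next object appears with probability `1 - p`, and either
falls below `x` and changes nothing, or ends the wait. -/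
theorem closed_fixed (hp0 : 0 < p) (hp1 : p < 1) {x : ℝ} (hx : x ≤ 1) :
    nextPayoffClosed p x =
      (1 - p) * (x * nextPayoffClosed p x + ∫ v in x..1, payoff p v) := by
  rw [integral_payoff hp0 hp1 hx, nextPayoffClosed]
  have := (hp0.trans_le (le_denom hp1 hx)).ne'
  field_simp
  ring

/-- The optimality equation. -/
theorem contValue_fixed (hp0 : 0 < p) (hp1 : p < 1) (hs : IsThreshold p s) {x : ℝ}
    (hx0 : 0 ≤ x) (hx : x ≤ 1) :
    IntervalIntegrable (stopValue p s) volume x 1 ∧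
    contValue p s x = (1 - p) * (x * contValue p s x + ∫ v in x..1, stopValue p s v) := by
  have key : ∀ y, s ≤ y → y ≤ 1 → IntervalIntegrable (stopValue p s) volume y 1 ∧
      ∫ v in y..1, stopValue p s v = ∫ v in y..1, payoff p v := by
    intro y hy hy1
    have hE : EqOn (stopValue p s) (payoff p) (uIcc y 1) := fun v hv => by
      rw [uIcc_of_le hy1] at hv
      exact stopValue_of_le hp0 hp1 hs (hy.trans hv.1) hv.2
    exact ⟨(intervalIntegrable_payoff hp0 hp1 hy1 le_rfl).congr
      (fun v hv => (hE (uIoc_subset_uIcc hv)).symm), intervalIntegral.integral_congr hE⟩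
  rcases le_or_gt s x with h | h
  · refine ⟨(key x h hx).1, ?_⟩
    rw [(key x h hx).2, contValue, max_eq_left h]
    exact closed_fixed hp0 hp1 hx
  -- The endpoint `v = s` belongs to the stopping branch and is dropped as a null set.
  · have hE : ∀ᵐ v, v ∈ uIoc x s → contValue p s s = stopValue p s v := by
      filter_upwards [compl_mem_ae_iff.2 (measure_singleton s)] with v hvs hv
      rw [uIoc_of_le h.le] at hv
      exact (stopValue_of_lt hp0 hp1 hs (lt_of_le_of_ne hv.2 hvs) (hx0.trans hv.1.le)).symm
    have hI : IntervalIntegrable (stopValue p s) volume x s :=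
      (intervalIntegrable_const (c := contValue p s s)).congr_ae
        ((ae_restrict_iff' measurableSet_uIoc).2 hE)
    have h1 := (key s le_rfl hs.lt_one.le)
    refine ⟨hI.trans h1.1, ?_⟩
    -- The constant stretch contributes `(s - x) V(s)`, which turns `x V(s)` into `s V(s)` and
    -- reduces the equation at `x` to the one at `s`.
    rw [← intervalIntegral.integral_add_adjacent_intervals hI h1.1, h1.2,
      ← intervalIntegral.integral_congr_ae hE, intervalIntegral.integral_const, smul_eq_mul]
    have e : contValue p s x = contValue p s s := by rw [contValue, contValue, max_eq_right h.le,
      max_self]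
    have := closed_fixed hp0 hp1 hs.lt_one.le
    rw [e]
    have e' : contValue p s s = nextPayoffClosed p s := by rw [contValue, max_self]
    rw [e']
    linear_combination this

/-- Boundedness serves to make the remainder in `gain` vanish: the denominator is at least `p`, and
`w ≤ w(1)` on an interval of length at most one. -/
theorem exists_contValue_le (hp0 : 0 < p) (hp1 : p < 1) (hs0 : 0 ≤ s) (hs1 : s ≤ 1) :
    ∃ C : ℝ, ∀ x ≤ 1, contValue p s x ≤ C := by
  refine ⟨(1 - p) / p * ((1 - 0) * payoff p 1), fun x hx => ?_⟩
  have h0 : 0 ≤ max x s := hs0.trans (le_max_right _ _)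
  have h1 : max x s ≤ 1 := max_le hx hs1
  rw [contValue, ← nextPayoff_eq_closed hp0 hp1 h0 h1, nextPayoff_eq_mul_integral hp0 hp1 h0 h1]
  refine mul_le_mul (div_le_div_of_nonneg_left (by linarith) hp0 (le_denom hp1 h1)) ?_
    (integral_payoff_nonneg hp0 hp1 h1) (div_nonneg (by linarith) hp0.le)
  calc ∫ v in (max x s)..1, payoff p v ≤ ∫ v in (max x s)..1, payoff p 1 :=
        intervalIntegral.integral_mono_on h1 (intervalIntegrable_payoff hp0 hp1 h1 le_rfl)
          intervalIntegrable_const fun v hv =>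
            payoff_monotoneOn hp0 hp1 (mem_Iic.2 hv.2) (mem_Iic.2 le_rfl) hv.2
    _ ≤ (1 - 0) * payoff p 1 := by
        rw [intervalIntegral.integral_const, smul_eq_mul]
        exact mul_le_mul_of_nonneg_right (by linarith) (payoff_nonneg hp0 hp1 le_rfl)

end Payoff

/-! ### Relative ranks, maturities and durations along a path -/

section Path

variable {Ω : Type*} {X : ℕ → Ω → ℝ} {N : Ω → ℕ} {n : ℕ} {ω : Ω}

open Classical in
theorem relRank_succ (n m : ℕ) (ω : Ω) :
    relRank X n (m + 1) ω = relRank X n m ω + if X n ω < X (m + 1) ω then 1 else 0 := by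
  unfold relRank
  rw [← Finset.insert_Icc_right_eq_Icc_add_one (by omega), Finset.filter_insert]
  split_ifs with h
  · rw [Finset.card_insert_of_notMem (by simp), add_assoc]
  · rfl

theorem relRank_mono (n : ℕ) (ω : Ω) : Monotone fun m => relRank X n m ω :=
  monotone_nat_of_le_succ fun m => by simp only [relRank_succ]; omega

theorem one_le_relRank (n m : ℕ) (ω : Ω) : 1 ≤ relRank X n m ω := by
  unfold relRank
  omega

theorem IsRelMax.relRank_self (h : IsRelMax X n ω) : relRank X n n ω = 1 := by
  rw [relRank, Finset.filter_eq_empty_iff.2, Finset.card_empty]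
  intro j hj
  rw [Finset.mem_Icc] at hj
  exact not_lt.2 (h j hj.1 hj.2)

/-- Ranks only get worse, so survival past `n + k` is decided at that time alone; `N ω` lies in the
set, so the infimum is attained. -/
theorem lt_maturity_iff (hn : n ≤ N ω) (k : ℕ) :
    n + k < maturity X N n ω ↔ n + k + 1 ≤ N ω ∧ relRank X n (n + k) ω ≤ 2 := by
  unfold maturity
  set S := {m | n ≤ m ∧ (2 < relRank X n m ω ∨ m = N ω)}
  have hN : N ω ∈ S := ⟨hn, Or.inr rfl⟩
  constructor
  · intro h
    refine ⟨h.trans_le (Nat.sInf_le hN), ?_⟩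
    by_contra! h2
    exact Nat.notMem_of_lt_sInf h ⟨by omega, Or.inl h2⟩
  · rintro ⟨h1, h2⟩
    by_contra! h3
    obtain ⟨-, h | h⟩ := Nat.sInf_mem ⟨_, hN⟩
    · have := relRank_mono (X := X) n ω h3
      simp only at this
      omega
    · omega

theorem le_maturity (hn : n ≤ N ω) : n ≤ maturity X N n ω :=
  (Nat.sInf_mem (s := {m | n ≤ m ∧ (2 < relRank X n m ω ∨ m = N ω)})
    ⟨N ω, hn, Or.inr rfl⟩).1

theorem duration_nonneg (n : ℕ) (ω : Ω) : 0 ≤ duration X N n ω := by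
  unfold duration
  split_ifs with h
  · exact sub_nonneg.2 (Nat.cast_le.2 (le_maturity h))
  · exact le_rfl

theorem reward_nonneg (τ : Ω → WithTop ℕ) (ω : Ω) : 0 ≤ reward X N τ ω := by
  unfold reward
  split_ifs
  · exact le_rfl
  · exact duration_nonneg _ _

/-- The event that the `n`-th object is still relatively best or second best at time `n + k`, and
that at least one more object appears. -/
def aliveSet (X : ℕ → Ω → ℝ) (N : Ω → ℕ) (n k : ℕ) : Set Ω :=
  {ω | relRank X n (n + k) ω ≤ 2} ∩ {ω | n + k + 1 ≤ N ω}

/-- A natural number counts the `k` below it; expected durations thereby become sums of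
probabilities. If object `n` never appears, all indicators vanish. -/
theorem ofReal_duration (n : ℕ) (ω : Ω) : ENNReal.ofReal (duration X N n ω) =
    ∑' k, (aliveSet X N n k).indicator 1 ω := by
  classical
  unfold duration
  split_ifs with h
  · obtain ⟨T, hT⟩ := Nat.exists_eq_add_of_le (le_maturity (X := X) h)
    have hmem : ∀ k, ω ∈ aliveSet X N n k ↔ k < T := fun k => by
      rw [aliveSet, mem_inter_iff, and_comm]
      refine (lt_maturity_iff h k).symm.trans ?_
      omega
    rw [tsum_eq_sum (s := Finset.range T) fun k hk => ?_,
      Finset.sum_congr rfl (g := fun _ => (1 : ℝ≥0∞)) fun k hk => ?_, hT]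
    · simp
    · rw [indicator_of_mem ((hmem k).2 (Finset.mem_range.1 hk)), Pi.one_apply]
    · rw [indicator_of_notMem fun h' => hk (Finset.mem_range.2 ((hmem k).1 h'))]
  · rw [ENNReal.ofReal_zero, eq_comm, ENNReal.tsum_eq_zero]
    intro k
    refine indicator_of_notMem (fun h' => h ?_) _
    have := h'.2
    rw [mem_ofPred_eq] at this
    omega

theorem ofReal_reward {τ : Ω → WithTop ℕ} (h0 : τ ω ≠ 0) : ENNReal.ofReal (reward X N τ ω) =
    ∑' m : ℕ, {ω | τ ω = ((m + 1 : ℕ) : WithTop ℕ)}.indicator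
      (fun ω => ENNReal.ofReal (duration X N (m + 1) ω)) ω := by
  classical
  unfold reward
  split_ifs with h
  · rw [ENNReal.ofReal_zero, eq_comm, ENNReal.tsum_eq_zero]
    intro m
    exact indicator_of_notMem (fun h' => WithTop.coe_ne_top (h'.symm.trans h)) _
  · obtain ⟨k, hk⟩ := WithTop.ne_top_iff_exists.1 h
    have hk0 : k ≠ 0 := by
      rintro rfl
      exact h0 hk.symm
    obtain ⟨m, rfl⟩ := Nat.exists_eq_succ_of_ne_zero hk0
    rw [tsum_eq_single m fun m' hm' => indicator_of_notMem (fun h' => hm' ?_) _,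
      indicator_of_mem (s := {ω | τ ω = ((m + 1 : ℕ) : WithTop ℕ)}) hk.symm, ← hk,
      WithTop.untopD_coe]
    rw [mem_ofPred_eq, ← hk] at h'
    exact (Nat.succ_injective (WithTop.coe_inj.1 h')).symm

theorem dite_find_eq_coe_iff {Q : ℕ → Prop} [DecidablePred Q] [Decidable (∃ m, Q m)] (m : ℕ) :
    (if h : ∃ m, Q m then ((Nat.find h : ℕ) : WithTop ℕ) else ⊤) = (m : WithTop ℕ) ↔
      Q m ∧ ∀ j < m, ¬ Q j := by
  split_ifs with h
  · exact WithTop.coe_inj.trans (Nat.find_eq_iff h)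
  · exact ⟨fun h' => absurd h'.symm WithTop.coe_ne_top, fun h' => absurd ⟨m, h'.1⟩ h⟩

theorem eq_of_forall_coe_iff {a b : WithTop ℕ}
    (h : ∀ m : ℕ, a = (m : WithTop ℕ) ↔ b = (m : WithTop ℕ)) : a = b := by
  induction a using WithTop.recTopCoe with
  | top =>
    induction b using WithTop.recTopCoe with
    | top => rfl
    | coe m => exact (h m).2 rfl
  | coe m => exact ((h m).1 rfl).symm

open Classical in
theorem nextRelMax_eq_coe_iff (m : ℕ) : nextRelMax X N n ω = (m : WithTop ℕ) ↔
    (n < m ∧ m ≤ N ω ∧ IsRelMax X m ω) ∧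
      ∀ j < m, ¬ (n < j ∧ j ≤ N ω ∧ IsRelMax X j ω) :=
  dite_find_eq_coe_iff m

open Classical in
theorem firstRelMaxIn_eq_coe_iff {S : Set ℝ} (m : ℕ) :
    firstRelMaxIn X N S ω = (m : WithTop ℕ) ↔
      (1 ≤ m ∧ m ≤ N ω ∧ IsRelMax X m ω ∧ X m ω ∈ S) ∧
      ∀ j < m, ¬ (1 ≤ j ∧ j ≤ N ω ∧ IsRelMax X j ω ∧ X j ω ∈ S) :=
  dite_find_eq_coe_iff m

theorem firstRelMaxIn_le {S : Set ℝ} {m : ℕ}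
    (hm : 1 ≤ m ∧ m ≤ N ω ∧ IsRelMax X m ω ∧ X m ω ∈ S) :
    firstRelMaxIn X N S ω ≤ (m : WithTop ℕ) := by
  classical
  have hex : ∃ m, 1 ≤ m ∧ m ≤ N ω ∧ IsRelMax X m ω ∧ X m ω ∈ S := ⟨m, hm⟩
  rw [(firstRelMaxIn_eq_coe_iff (Nat.find hex)).2
    ⟨Nat.find_spec hex, fun j hj => Nat.find_min hex hj⟩]
  exact WithTop.coe_le_coe.2 (Nat.find_min' hex hm)

theorem firstRelMaxIn_congr {S S' : Set ℝ} (h : ∀ k, 1 ≤ k → (X k ω ∈ S ↔ X k ω ∈ S')) :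
    firstRelMaxIn X N S ω = firstRelMaxIn X N S' ω := by
  have hQ : ∀ m, (1 ≤ m ∧ m ≤ N ω ∧ IsRelMax X m ω ∧ X m ω ∈ S) ↔
      (1 ≤ m ∧ m ≤ N ω ∧ IsRelMax X m ω ∧ X m ω ∈ S') := fun m =>
    and_congr_right fun hm => by rw [h m hm]
  have key : ∀ m : ℕ, firstRelMaxIn X N S ω = (m : WithTop ℕ) ↔
      firstRelMaxIn X N S' ω = (m : WithTop ℕ) := fun m => by
    simp only [firstRelMaxIn_eq_coe_iff, hQ]
  exact eq_of_forall_coe_iff key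

/-- The running maximum of the values `X 1, …, X n` (equal to `X 1` for `n = 0`). -/
def runMax (X : ℕ → Ω → ℝ) : ℕ → Ω → ℝ
  | 0, ω => X 1 ω
  | n + 1, ω => max (runMax X n ω) (X (n + 1) ω)

theorem runMax_le_iff {a : ℝ} (n : ℕ) :
    runMax X (n + 1) ω ≤ a ↔ ∀ j, 1 ≤ j → j ≤ n + 1 → X j ω ≤ a := by
  induction n with
  | zero =>
    simp only [runMax, zero_add, max_self]
    exact ⟨fun h j h1 h2 => by rwa [le_antisymm h2 h1], fun h => h 1 le_rfl le_rfl⟩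
  | succ n ih =>
    rw [runMax, max_le_iff, ih]
    constructor
    · rintro ⟨h1, h2⟩ j hj1 hj2
      rcases Nat.lt_or_ge (n + 1) j with h | h
      · rwa [le_antisymm hj2 h]
      · exact h1 j hj1 h
    · exact fun h => ⟨fun j h1 h2 => h j h1 (by omega), h _ (by omega) le_rfl⟩

/-- The convention `runMax X 0 = X 1` makes the first object a relative maximum, so later one-step
comparisons include `n = 0`. -/
theorem isRelMax_succ_iff (n : ℕ) : IsRelMax X (n + 1) ω ↔ runMax X n ω ≤ X (n + 1) ω := by
  rw [IsRelMax]
  cases n with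
  | zero => simpa [runMax] using fun j h1 h2 => by rw [show j = 1 by omega]
  | succ n =>
    rw [runMax_le_iff]
    refine ⟨fun h j h1 h2 => h j h1 (by omega), fun h j h1 h2 => ?_⟩
    rcases Nat.lt_or_ge (n + 1) j with h' | h'
    · rw [show j = n + 1 + 1 by omega]
    · exact h j h1 h'

theorem runMax_mem_Icc (h : ∀ k, 1 ≤ k → X k ω ∈ Icc (0 : ℝ) 1) (n : ℕ) :
    runMax X n ω ∈ Icc (0 : ℝ) 1 := by
  induction n with
  | zero => exact h 1 le_rfl
  | succ n ih => exact ⟨ih.1.trans (le_max_left _ _), max_le ih.2 (h _ (by omega)).2⟩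

end Path

/-! ### Measurability -/

section Measurability

variable {Ω : Type*} {m : MeasurableSpace Ω} {X : ℕ → Ω → ℝ}

/-- The σ-algebra is arbitrary, so that the statement applies to `info` as well as to the ambient
one. -/
theorem measurable_relRank {n : ℕ} (hn : Measurable (X n)) {j : ℕ}
    (h : ∀ k, 1 ≤ k → k ≤ j → Measurable (X k)) : Measurable (relRank X n j) := by
  classical
  induction j with
  | zero => exact measurable_const
  | succ j ih =>
    have : relRank X n (j + 1) =
        fun ω => relRank X n j ω + if X n ω < X (j + 1) ω then 1 else 0 :=
      funext fun ω => relRank_succ n j ω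
    rw [this]
    exact (ih fun k h1 h2 => h k h1 (by omega)).add (Measurable.ite
      (measurableSet_lt hn (h _ (by omega) le_rfl)) measurable_const measurable_const)

theorem measurableSet_isRelMax {n : ℕ} (h : ∀ k, 1 ≤ k → k ≤ n → Measurable (X k)) :
    MeasurableSet {ω | IsRelMax X n ω} := by
  have : {ω | IsRelMax X n ω} = ⋂ j ∈ Icc 1 n, {ω | X j ω ≤ X n ω} := by
    ext ω
    simp [IsRelMax]
  rw [this]
  refine MeasurableSet.biInter (to_countable _) fun j hj => ?_
  exact measurableSet_le (h j hj.1 hj.2) (h n (hj.1.trans hj.2) le_rfl)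

theorem measurable_runMax {n : ℕ} (h : ∀ k, 1 ≤ k → k ≤ n + 1 → Measurable (X k)) :
    ∀ i ≤ n, Measurable (runMax X (i + 1)) := by
  intro i hi
  induction i with
  | zero => exact (h 1 le_rfl (by omega)).max (h 1 le_rfl (by omega))
  | succ i ih => exact (ih (by omega)).max (h _ (by omega) (by omega))

end Measurability

/-! ### The model and its Markov property -/

/-- The standing assumptions on the values and on the horizon. -/
structure Model {Ω : Type*} [MeasurableSpace Ω] (p : ℝ) (P : Measure Ω) (X : ℕ → Ω → ℝ)
    (N : Ω → ℕ) : Prop where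
  pos : 0 < p
  lt_one : p < 1
  measurable_X : ∀ k, 1 ≤ k → Measurable (X k)
  measurable_N : Measurable N
  map_X : ∀ k, 1 ≤ k → P.map (X k) = volume.restrict (Icc (0 : ℝ) 1)
  iIndepFun_X : iIndepFun (fun k : ℕ => X (k + 1)) P
  indepFun_N : IndepFun (fun ω (k : ℕ) => X (k + 1) ω) N P
  measure_N : ∀ k : ℕ, P {ω | N ω = k + 1} = ENNReal.ofReal (p * (1 - p) ^ k)

/-- The σ-algebra generated by the first `n` values. -/
@[reducible]
def past {Ω : Type*} (X : ℕ → Ω → ℝ) (n : ℕ) : MeasurableSpace Ω :=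
  ⨆ k ∈ Iio n, MeasurableSpace.comap (X (k + 1)) inferInstance

section Past

variable {Ω : Type*} {X : ℕ → Ω → ℝ} {N : Ω → ℕ} {n k : ℕ}

theorem measurable_past (hk : 1 ≤ k) (hkn : k ≤ n) : Measurable[past X n] (X k) := by
  obtain ⟨j, rfl⟩ := Nat.exists_eq_add_of_le' hk
  exact Measurable.of_comap_le
    (le_iSup₂_of_le (f := fun k (_ : k ∈ Iio n) => MeasurableSpace.comap (X (k + 1)) inferInstance)
      j (mem_Iio.2 (by omega)) le_rfl)

theorem past_mono {n m : ℕ} (h : n ≤ m) : past X n ≤ past X m :=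
  biSup_mono fun _ hk => lt_of_lt_of_le hk h

variable [mΩ : MeasurableSpace Ω] {hX : ∀ k, 1 ≤ k → Measurable (X k)} {hN : Measurable N}

theorem past_le_info : past X n ≤ info X N hX hN n :=
  iSup₂_le fun k hk => by
    have hk' : k + 1 ∈ Icc 1 n := ⟨by omega, hk⟩
    exact le_sup_left.trans (le_iSup₂_of_le (f := fun k (_ : k ∈ Icc 1 n) =>
      (MeasurableSpace.comap (X k) inferInstance ⊔
        MeasurableSpace.comap (fun ω => k ≤ N ω) ⊤)) (k + 1) hk' le_rfl)

theorem past_le (hX : ∀ k, 1 ≤ k → Measurable (X k)) : past X n ≤ mΩ :=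
  iSup₂_le fun k _ => (hX (k + 1) (by omega)).comap_le

theorem measurable_info (hk : 1 ≤ k) (hkn : k ≤ n) : Measurable[info X N hX hN n] (X k) :=
  (measurable_past hk hkn).mono past_le_info le_rfl

theorem measurableSet_info_le (hk : 1 ≤ k) (hkn : k ≤ n) :
    MeasurableSet[info X N hX hN n] {ω | k ≤ N ω} := by
  have h : MeasurableSpace.comap (fun ω => k ≤ N ω) ⊤ ≤ info X N hX hN n :=
    le_sup_right.trans (le_iSup₂_of_le (f := fun k (_ : k ∈ Icc 1 n) =>
      (MeasurableSpace.comap (X k) inferInstance ⊔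
        MeasurableSpace.comap (fun ω => k ≤ N ω) ⊤)) k ⟨hk, hkn⟩ le_rfl)
  exact h _ ⟨{True}, trivial, by ext ω; simp⟩

theorem measurableSet_info_isRelMax : MeasurableSet[info X N hX hN n] {ω | IsRelMax X n ω} :=
  measurableSet_isRelMax fun _ h1 h2 => measurable_info h1 h2

/-- On the event that the `n`-th object appears, the information at time `n` is that of the first
`n` values. -/
theorem exists_past_inter_eq {D : Set Ω} (hD : MeasurableSet[info X N hX hN n] D) :
    ∃ D', MeasurableSet[past X n] D' ∧ D ∩ {ω | n ≤ N ω} = D' ∩ {ω | n ≤ N ω} := by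
  -- The sets with this property form a σ-algebra, so only the generators of `info` need checking.
  have ⟨m, hm⟩ : ∃ m : MeasurableSpace Ω, ∀ D, MeasurableSet[m] D ↔
      ∃ D', MeasurableSet[past X n] D' ∧ D ∩ {ω | n ≤ N ω} = D' ∩ {ω | n ≤ N ω} := by
    refine ⟨⟨fun D => ∃ D', MeasurableSet[past X n] D' ∧
      D ∩ {ω | n ≤ N ω} = D' ∩ {ω | n ≤ N ω}, ⟨∅, @MeasurableSet.empty _ (past X n), rfl⟩,
      fun D ⟨D', h, e⟩ => ⟨D'ᶜ, h.compl, ?_⟩, fun D hD => ?_⟩, fun _ => Iff.rfl⟩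
    · rw [← sdiff_eq_compl_inter, ← sdiff_eq_compl_inter, ← sdiff_inter_self_eq_sdiff, e,
        sdiff_inter_self_eq_sdiff]
    · choose D' h e using hD
      exact ⟨⋃ i, D' i, MeasurableSet.iUnion h, by simp only [iUnion_inter, e]⟩
  have hle : @LE.le (MeasurableSpace Ω) _ (@info Ω mΩ X N hX hN n) m := by
    refine iSup₂_le fun k hk => sup_le ?_ ?_
    · intro D hD
      exact (hm D).2 ⟨D, (measurable_past hk.1 hk.2).comap_le _ hD, rfl⟩
    · rintro D ⟨S, -, rfl⟩
      rw [hm]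
      -- On `{n ≤ N}` the proposition `k ≤ N ω` is true, so the trace of the preimage is everything
      -- or nothing.
      refine ⟨{_ω | True ∈ S}, @MeasurableSet.const _ (past X n) _, ?_⟩
      ext ω
      refine and_congr_left fun hω => ?_
      have : (k ≤ N ω) = True := eq_true (hk.2.trans hω)
      simp only [mem_preimage, mem_ofPred_eq, this]
  exact (hm D).1 (hle D hD)

end Past

/-- The uniform distribution on `[0, 1]`. -/
noncomputable abbrev unif : Measure ℝ := volume.restrict (Icc (0 : ℝ) 1)

instance : IsProbabilityMeasure unif := ⟨by simp [unif]⟩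

namespace Model

variable {Ω : Type*} [mΩ : MeasurableSpace Ω] {p : ℝ} {P : Measure Ω}
  {X : ℕ → Ω → ℝ} {N : Ω → ℕ} {hX : ∀ k, 1 ≤ k → Measurable (X k)} {hN : Measurable N} {n : ℕ}

theorem ae_mem_Icc (h : Model p P X N) : ∀ᵐ ω ∂P, ∀ k, 1 ≤ k → X k ω ∈ Icc (0 : ℝ) 1 := by
  rw [ae_all_iff]
  intro k
  by_cases hk : 1 ≤ k
  · have : ∀ᵐ x ∂(P.map (X k)), x ∈ Icc (0 : ℝ) 1 := by
      rw [h.map_X k hk]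
      exact ae_restrict_mem measurableSet_Icc
    filter_upwards [ae_of_ae_map (h.measurable_X k hk).aemeasurable this] with ω hω _ using hω
  · exact Filter.Eventually.of_forall fun ω hk' => absurd hk' hk

theorem measurableSet_le_N (h : Model p P X N) (k : ℕ) : MeasurableSet {ω | k ≤ N ω} :=
  measurableSet_le measurable_const h.measurable_N

/-- The masses at `1, 2, …` already sum to one, which rules out the value `0` almost surely. -/
theorem measure_one_le (h : Model p P X N) : P {ω | 1 ≤ N ω} = 1 := by
  have hU : {ω | 1 ≤ N ω} = ⋃ k : ℕ, {ω | N ω = k + 1} := by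
    ext ω
    simp only [mem_ofPred_eq, mem_iUnion]
    exact ⟨fun hω => ⟨N ω - 1, by omega⟩, fun ⟨k, hk⟩ => by omega⟩
  have hmeas : ∀ k : ℕ, MeasurableSet {ω | N ω = k + 1} := fun k =>
    h.measurable_N (measurableSet_singleton (k + 1))
  rw [hU, measure_iUnion (fun i j hij => ?_) hmeas]
  · simp only [h.measure_N]
    have h1 := h.lt_one
    have h0 := h.pos
    rw [← ENNReal.ofReal_tsum_of_nonneg (fun k => by have : 0 ≤ 1 - p := by linarith
                                                     positivity)
      ((summable_geometric_of_lt_one (by linarith) (by linarith)).mul_left p), tsum_mul_left,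
      tsum_geometric_of_lt_one (by linarith) (by linarith), sub_sub_cancel,
      mul_inv_cancel₀ h0.ne', ENNReal.ofReal_one]
  · rw [Function.onFun, disjoint_left]
    intro ω hi hj
    rw [mem_ofPred_eq] at hi hj
    omega

theorem measure_succ_le (h : Model p P X N) (k : ℕ) :
    P {ω | k + 1 ≤ N ω} = ENNReal.ofReal (1 - p) ^ k := by
  induction k with
  | zero => simpa using h.measure_one_le
  | succ k ih =>
    have hU : {ω | k + 1 ≤ N ω} = {ω | N ω = k + 1} ∪ {ω | k + 1 + 1 ≤ N ω} := by
      ext ω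
      simp only [mem_ofPred_eq, mem_union]
      omega
    rw [hU, measure_union (by
      rw [disjoint_left]
      intro ω hi hj
      rw [mem_ofPred_eq] at hi hj
      omega) (h.measurableSet_le_N _), h.measure_N] at ih
    have hq : 0 ≤ 1 - p := by linarith [h.lt_one]
    have e : ENNReal.ofReal (1 - p) ^ k =
        ENNReal.ofReal (p * (1 - p) ^ k) + ENNReal.ofReal (1 - p) ^ (k + 1) := by
      rw [← ENNReal.ofReal_pow hq, ← ENNReal.ofReal_pow hq,
        ← ENNReal.ofReal_add (mul_nonneg h.pos.le (pow_nonneg hq _)) (pow_nonneg hq _)]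
      congr 1
      ring
    rw [e] at ih
    exact (ENNReal.add_right_inj ENNReal.ofReal_ne_top).1 ih

theorem indep_past_X (h : Model p P X N) :
    Indep (past X n) (MeasurableSpace.comap (X (n + 1)) inferInstance) P := by
  have := indep_iSup_of_disjoint (m := fun k => MeasurableSpace.comap (X (k + 1)) inferInstance)
    (fun k => (h.measurable_X (k + 1) (by omega)).comap_le) h.iIndepFun_X
    (S := Iio n) (T := {n}) (by simp)
  simpa [past] using this

theorem indep_past_N (h : Model p P X N) :
    Indep (past X n) (MeasurableSpace.comap N inferInstance) P := by
  refine indep_of_indep_of_le_left h.indepFun_N (iSup₂_le fun k _ => ?_)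
  have : X (k + 1) = (fun f : ℕ → ℝ => f k) ∘ fun ω (k : ℕ) => X (k + 1) ω := rfl
  rw [this, ← MeasurableSpace.comap_comp]
  exact MeasurableSpace.comap_mono (measurable_pi_apply k).comap_le

theorem lintegral_past_inter (h : Model p P X N) {D : Set Ω} (hD : MeasurableSet[past X n] D)
    {f : Ω → ℝ≥0∞} (hf : Measurable[past X n] f) (k : ℕ) :
    ∫⁻ ω in D ∩ {ω | k ≤ N ω}, f ω ∂P = (∫⁻ ω in D, f ω ∂P) * P {ω | k ≤ N ω} := by
  have hle := past_le (n := n) h.measurable_X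
  rw [← setLIntegral_indicator (hle _ hD), ← lintegral_indicator (h.measurableSet_le_N k),
    ← lintegral_indicator (hle _ hD), ← lintegral_indicator_one (h.measurableSet_le_N k),
    ← lintegral_mul_eq_lintegral_mul_lintegral_of_independent_measurableSpace hle
      h.measurable_N.comap_le h.indep_past_N (hf.indicator hD)
      (g := {ω | k ≤ N ω}.indicator 1)
      (Measurable.indicator measurable_const ⟨Ici k, measurableSet_Ici, rfl⟩)]
  refine lintegral_congr fun ω => ?_
  by_cases hω : k ≤ N ω <;> simp [indicator, hω]

variable [IsProbabilityMeasure P]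

theorem ae_one_le (h : Model p P X N) : ∀ᵐ ω ∂P, 1 ≤ N ω :=
  (mem_ae_iff_prob_eq_one (h.measurableSet_le_N 1)).2 h.measure_one_le

theorem lintegral_past_prod (h : Model p P X N) {D : Set Ω} (hD : MeasurableSet[past X n] D)
    {Y : Ω → ℝ} (hY : Measurable[past X n] Y) {H : ℝ → ℝ → ℝ≥0∞}
    (hH : Measurable (Function.uncurry H)) :
    ∫⁻ ω in D, H (Y ω) (X (n + 1) ω) ∂P = ∫⁻ ω in D, ∫⁻ v, H (Y ω) v ∂unif ∂P := by
  have hle := past_le (n := n) h.measurable_X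
  have hXn := h.measurable_X (n + 1) (by omega)
  -- Carrying the indicator of `D` along with `Y` puts the restriction to `D` into the integrand, so
  -- the product law and Tonelli apply.
  set Z : Ω → ℝ≥0∞ × ℝ := fun ω => (D.indicator 1 ω, Y ω)
  have hZm : Measurable[past X n] Z :=
    (Measurable.indicator measurable_const hD).prodMk hY
  have hind : IndepFun Z (X (n + 1)) P :=
    indep_of_indep_of_le_left h.indep_past_X hZm.comap_le
  have hZm' : Measurable Z := hZm.mono hle le_rfl
  have hmap := (indepFun_iff_map_prod_eq_prod_map_map hZm'.aemeasurable hXn.aemeasurable).1 hind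
  have hF : Measurable fun z : (ℝ≥0∞ × ℝ) × ℝ => z.1.1 * H z.1.2 z.2 :=
    (measurable_fst.comp measurable_fst).mul
      (hH.comp ((measurable_snd.comp measurable_fst).prodMk measurable_snd))
  have hH' : ∀ y, Measurable (H y) := fun y => hH.comp (measurable_const.prodMk measurable_id)
  have e' : ∀ (g : Ω → ℝ≥0∞), ∫⁻ ω in D, g ω ∂P = ∫⁻ ω, (Z ω).1 * g ω ∂P := fun g => by
    rw [← lintegral_indicator (hle _ hD)]
    refine lintegral_congr fun ω => ?_
    by_cases hω : ω ∈ D <;> simp [Z, hω]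
  calc ∫⁻ ω in D, H (Y ω) (X (n + 1) ω) ∂P
      = ∫⁻ z, z.1.1 * H z.1.2 z.2 ∂(P.map fun ω => (Z ω, X (n + 1) ω)) := by
        rw [lintegral_map hF (hZm'.prodMk hXn), e']
    _ = ∫⁻ z, ∫⁻ v, z.1 * H z.2 v ∂unif ∂(P.map Z) := by
        rw [hmap, h.map_X _ (by omega), lintegral_prod _ hF.aemeasurable]
    _ = ∫⁻ z, z.1 * ∫⁻ v, H z.2 v ∂unif ∂(P.map Z) :=
        lintegral_congr fun z => lintegral_const_mul _ (hH' _)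
    _ = ∫⁻ ω in D, ∫⁻ v, H (Y ω) v ∂unif ∂P := by
        rw [e']
        exact lintegral_map
          (measurable_fst.mul (hH.lintegral_prod_right'.comp measurable_snd)) hZm'

/-- The Markov property: given that object `n` appears, the next one appears with probability
`1 - p`, and its value is uniform and independent of the past. -/
theorem lintegral_step (h : Model p P X N) (hn : 1 ≤ n) {D : Set Ω}
    (hD : MeasurableSet[info X N hX hN n] D) {Y : Ω → ℝ} (hY : Measurable[past X n] Y)
    {H : ℝ → ℝ → ℝ≥0∞} (hH : Measurable (Function.uncurry H)) :
    ∫⁻ ω in D ∩ {ω | n + 1 ≤ N ω}, H (Y ω) (X (n + 1) ω) ∂P =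
      ∫⁻ ω in D ∩ {ω | n ≤ N ω}, ENNReal.ofReal (1 - p) * ∫⁻ v, H (Y ω) v ∂unif ∂P := by
  obtain ⟨D', hD', e⟩ := exists_past_inter_eq hD
  have e' : D ∩ {ω | n + 1 ≤ N ω} = D' ∩ {ω | n + 1 ≤ N ω} := by
    have hs : {ω | n + 1 ≤ N ω} = {ω | n ≤ N ω} ∩ {ω | n + 1 ≤ N ω} := by
      ext ω
      simp only [mem_ofPred_eq, mem_inter_iff]
      omega
    rw [hs, ← inter_assoc, e, inter_assoc]
  have hY' : Measurable[past X (n + 1)] fun ω => (Y ω, X (n + 1) ω) :=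
    (hY.mono (past_mono n.le_succ) le_rfl).prodMk (measurable_past (by omega) le_rfl)
  have hG : Measurable fun y => ∫⁻ v, H y v ∂unif := hH.lintegral_prod_right'
  -- With `n = k + 1` the horizon contributes `(1-p)^(k+1)` on the left and `(1-p)^k` on the right;
  -- the ratio is the factor in the statement.
  obtain ⟨k, rfl⟩ := Nat.exists_eq_add_of_le' hn
  have h1 := h.lintegral_past_inter (past_mono (k + 1).le_succ _ hD') (hH.comp hY') (k + 1 + 1)
  have h2 := h.lintegral_past_inter hD' (hG.comp hY) (k + 1)
  simp only [Function.comp_def, Function.uncurry_apply_pair] at h1 h2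
  rw [e', e, h1, h.lintegral_past_prod hD' hY hH, lintegral_const_mul' _ _ ENNReal.ofReal_ne_top,
    h2, h.measure_succ_le, h.measure_succ_le, pow_succ]
  ring

/-- The Markov step for a comparison of `X n` with the newest value. The free function `φ` allows
iteration: each step's factor, again a function of `X n`, is absorbed into it. -/
theorem lintegral_step_set (h : Model p P X N) (hn : 1 ≤ n) {m : ℕ} (hnm : n ≤ m) {D : Set Ω}
    (hD : MeasurableSet[info X N hX hN m] D) {φ : ℝ → ℝ≥0∞} (hφ : Measurable φ)
    {B : Set (ℝ × ℝ)} (hB : MeasurableSet B) :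
    ∫⁻ ω in D ∩ {ω | (X n ω, X (m + 1) ω) ∈ B} ∩ {ω | m + 1 ≤ N ω}, φ (X n ω) ∂P =
      ∫⁻ ω in D ∩ {ω | m ≤ N ω},
        φ (X n ω) * (ENNReal.ofReal (1 - p) * unif (Prod.mk (X n ω) ⁻¹' B)) ∂P := by
  have hm : MeasurableSet {ω | (X n ω, X (m + 1) ω) ∈ B} :=
    ((h.measurable_X n hn).prodMk (h.measurable_X (m + 1) (by omega))) hB
  have h1 := h.lintegral_step (hX := hX) (hN := hN) (hn.trans hnm) hD (measurable_past hn hnm)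
    (H := fun y v => B.indicator (fun z => φ z.1) (y, v))
    ((hφ.comp measurable_fst).indicator hB)
  rw [inter_right_comm, inter_comm _ {ω | (X n ω, X (m + 1) ω) ∈ B}, ← setLIntegral_indicator hm]
  refine Eq.trans ?_ (h1.trans ?_)
  · rfl
  · refine lintegral_congr fun ω => ?_
    have : ∫⁻ v, B.indicator (fun z => φ z.1) (X n ω, v) ∂unif =
        φ (X n ω) * unif (Prod.mk (X n ω) ⁻¹' B) := by
      rw [← lintegral_indicator_const (measurable_prodMk_left hB)]
      rfl
    rw [this]
    ring

end Model

/-! ### Integration against the uniform distribution -/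

section Unif

variable {y : ℝ}

theorem unif_Iio (hy : y ∈ Icc (0 : ℝ) 1) : unif (Iio y) = ENNReal.ofReal y := by
  rw [unif, Measure.restrict_apply measurableSet_Iio]
  have : Iio y ∩ Icc 0 1 = Ico 0 y := by
    ext v
    simp only [mem_inter_iff, mem_Iio, mem_Icc, mem_Ico]
    exact ⟨fun h => ⟨h.2.1, h.1⟩, fun h => ⟨h.2, h.1, h.2.le.trans hy.2⟩⟩
  rw [this, Real.volume_Ico, sub_zero]

theorem unif_Iic (hy : y ∈ Icc (0 : ℝ) 1) : unif (Iic y) = ENNReal.ofReal y := by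
  rw [← unif_Iio hy, measure_congr Iio_ae_eq_Iic]

theorem unif_Ioi (hy : y ∈ Icc (0 : ℝ) 1) : unif (Ioi y) = ENNReal.ofReal (1 - y) := by
  rw [← compl_Iic, prob_compl_eq_one_sub measurableSet_Iic, unif_Iic hy,
    ENNReal.ofReal_sub _ hy.1, ENNReal.ofReal_one]

/-- Used with `c = 0` for waiting for the next maximum, and with `c` the value of continuing in the
optimality equation. -/
theorem lintegral_unif_ite (hy : y ∈ Icc (0 : ℝ) 1) {f : ℝ → ℝ}
    (hf : IntervalIntegrable f volume y 1) (hf0 : ∀ v ≤ 1, 0 ≤ f v) (c : ℝ≥0∞) :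
    ∫⁻ v, (if y ≤ v then ENNReal.ofReal (f v) else c) ∂unif =
      ENNReal.ofReal (∫ v in y..1, f v) + c * ENNReal.ofReal y := by
  rw [← lintegral_add_compl _ (measurableSet_Ici (a := y)), compl_Ici,
    setLIntegral_congr_fun (f := fun v => if y ≤ v then ENNReal.ofReal (f v) else c)
      measurableSet_Ici (g := fun v => ENNReal.ofReal (f v)) (fun v hv => if_pos hv),
    setLIntegral_congr_fun (f := fun v => if y ≤ v then ENNReal.ofReal (f v) else c)
      measurableSet_Iio (g := fun _ => c) (fun v hv => if_neg (not_le.2 hv)),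
    setLIntegral_const, unif_Iio hy, unif, Measure.restrict_restrict measurableSet_Ici]
  have : Ici y ∩ Icc 0 1 = Icc y 1 := by
    ext v
    simp only [mem_inter_iff, mem_Ici, mem_Icc]
    exact ⟨fun h => ⟨h.1, h.2.2⟩, fun h => ⟨h.1, hy.1.trans h.1, h.2⟩⟩
  rw [this, intervalIntegral.integral_of_le hy.2, ← integral_Icc_eq_integral_Ioc,
    ofReal_integral_eq_lintegral_ofReal]
  · exact (intervalIntegrable_iff_integrableOn_Icc_of_le hy.2).1 hf
  · exact (ae_restrict_iff' measurableSet_Icc).2 (Filter.Eventually.of_forall fun v hv => hf0 v hv.2)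

end Unif

/-! ### The conditional expected duration -/

/-- The event that the `n`-th object has relative rank `r` at time `n + k`. -/
def rankSet {Ω : Type*} (X : ℕ → Ω → ℝ) (n k r : ℕ) : Set Ω :=
  {ω | relRank X n (n + k) ω = r}

section RankSet

variable {Ω : Type*} {X : ℕ → Ω → ℝ} {n k : ℕ} {ω : Ω}

theorem mem_rankSet_succ_one : ω ∈ rankSet X n (k + 1) 1 ↔
    ω ∈ rankSet X n k 1 ∧ X (n + k + 1) ω ≤ X n ω := by
  have := one_le_relRank (X := X) n (n + k) ω
  rw [← not_lt]
  simp only [rankSet, mem_ofPred_eq, ← add_assoc, relRank_succ]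
  split_ifs with hlt
  · exact iff_of_false (by omega) fun h => h.2 hlt
  · exact ⟨fun h => ⟨h, hlt⟩, fun h => h.1⟩

theorem mem_rankSet_succ_two : ω ∈ rankSet X n (k + 1) 2 ↔
    (ω ∈ rankSet X n k 2 ∧ X (n + k + 1) ω ≤ X n ω) ∨
      (ω ∈ rankSet X n k 1 ∧ X n ω < X (n + k + 1) ω) := by
  rw [← not_lt]
  simp only [rankSet, mem_ofPred_eq, ← add_assoc, relRank_succ]
  split_ifs with hlt
  · exact ⟨fun h => Or.inr ⟨by omega, hlt⟩, by rintro (h | h) <;> [exact absurd hlt h.2; omega]⟩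
  · exact ⟨fun h => Or.inl ⟨h, hlt⟩, by rintro (h | h) <;> [exact h.1; exact absurd h.2 hlt]⟩

theorem inter_rankSet_zero_one {D : Set Ω} (hD : D ⊆ {ω | IsRelMax X n ω}) :
    D ∩ rankSet X n 0 1 = D :=
  inter_eq_left.2 fun _ hω => (hD hω).relRank_self

theorem inter_rankSet_zero_two {D : Set Ω} (hD : D ⊆ {ω | IsRelMax X n ω}) :
    D ∩ rankSet X n 0 2 = ∅ := by
  refine eq_empty_of_forall_notMem fun ω hω => ?_
  have h1 := (hD hω.1).relRank_self
  have h2 : relRank X n n ω = 2 := hω.2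
  omega

theorem disjoint_rankSet (n k : ℕ) : Disjoint (rankSet X n k 2) (rankSet X n k 1) := by
  rw [disjoint_left]
  intro ω h1 h2
  simp only [rankSet, mem_ofPred_eq] at h1 h2
  omega

end RankSet

section Series

variable {p y : ℝ}

/-- The two series, for ranks one and two, sum to `q/(1-qy)` and `q·q(1-y)/(1-qy)²`; then `q(1-y) =
(1-qy) - p` yields the form of `payoff`. -/
theorem tsum_add_tsum_eq_payoff (hp0 : 0 < p) (hp1 : p < 1) (hy : y ∈ Icc (0 : ℝ) 1) :
    ∑' k : ℕ, ENNReal.ofReal (1 - p) * (ENNReal.ofReal (1 - p) * ENNReal.ofReal y) ^ k +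
      ∑' k : ℕ, ENNReal.ofReal (1 - p) * ((k + 1) *
        (ENNReal.ofReal (1 - p) * ENNReal.ofReal y) ^ k *
          (ENNReal.ofReal (1 - p) * ENNReal.ofReal (1 - y))) = ENNReal.ofReal (payoff p y) := by
  have hq : 0 ≤ 1 - p := by linarith
  have hy0 := hy.1
  have hy1 : 0 ≤ 1 - y := by linarith [hy.2]
  have hr : 0 ≤ (1 - p) * y := mul_nonneg hq hy0
  have hr1 : (1 - p) * y < 1 := by nlinarith [hy.2]
  have e1 : ∀ k : ℕ,
      ENNReal.ofReal (1 - p) * (ENNReal.ofReal (1 - p) * ENNReal.ofReal y) ^ k =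
        ENNReal.ofReal ((1 - p) * ((1 - p) * y) ^ k) := fun k => by
    rw [ENNReal.ofReal_mul hq, ENNReal.ofReal_pow hr, ENNReal.ofReal_mul hq]
  have e2 : ∀ k : ℕ, ENNReal.ofReal (1 - p) * ((k + 1) *
        (ENNReal.ofReal (1 - p) * ENNReal.ofReal y) ^ k *
          (ENNReal.ofReal (1 - p) * ENNReal.ofReal (1 - y))) =
        ENNReal.ofReal ((1 - p) * ((1 - p) * (1 - y)) *
          (((k + 1).choose 1 : ℕ) * ((1 - p) * y) ^ k)) := fun k => by
    rw [ENNReal.ofReal_mul (by positivity), ENNReal.ofReal_mul hq, ENNReal.ofReal_mul hq,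
      ENNReal.ofReal_mul (by positivity), ENNReal.ofReal_pow hr, ENNReal.ofReal_mul hq,
      ENNReal.ofReal_natCast, Nat.choose_one_right, Nat.cast_add, Nat.cast_one]
    ring
  have hs := hasSum_choose_mul_geometric_of_norm_lt_one 1
    (r := (1 - p) * y) (by rwa [Real.norm_of_nonneg hr])
  simp only [e1, e2]
  rw [← ENNReal.ofReal_tsum_of_nonneg (fun k => by positivity)
      ((summable_geometric_of_lt_one hr hr1).mul_left _),
    ← ENNReal.ofReal_tsum_of_nonneg (fun k => by positivity) (hs.summable.mul_left _),
    tsum_mul_left, tsum_mul_left, tsum_geometric_of_lt_one hr hr1, hs.tsum_eq,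
    ← ENNReal.ofReal_add]
  · congr 1
    rw [payoff]
    have : 1 - (1 - p) * y ≠ 0 := by linarith
    field_simp
    ring
  · exact mul_nonneg hq (inv_nonneg.2 (by linarith))
  · have : 0 ≤ 1 - (1 - p) * y := by linarith
    positivity

end Series

namespace Model

variable {Ω : Type*} [mΩ : MeasurableSpace Ω] {p : ℝ} {P : Measure Ω}
  {X : ℕ → Ω → ℝ} {N : Ω → ℕ} {hX : ∀ k, 1 ≤ k → Measurable (X k)} {hN : Measurable N} {n : ℕ}

theorem measurableSet_info_relRank {s : Set ℕ} (hn : 1 ≤ n) (k : ℕ) :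
    MeasurableSet[info X N hX hN (n + k)] {ω | relRank X n (n + k) ω ∈ s} :=
  measurable_relRank (m := info X N hX hN (n + k)) (measurable_info hn (by omega))
    (fun _ h1 h2 => measurable_info h1 h2) (MeasurableSet.of_discrete (s := s))

theorem measurableSet_info_rankSet (hn : 1 ≤ n) (k r : ℕ) :
    MeasurableSet[info X N hX hN (n + k)] (rankSet X n k r) :=
  measurableSet_info_relRank (s := {r}) hn k

theorem measurableSet_info_of_le {m : ℕ} {D : Set Ω} (hD : MeasurableSet[info X N hX hN n] D)
    (h : n ≤ m) : MeasurableSet[info X N hX hN m] D :=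
  (info X N hX hN).mono h _ hD

theorem info_measurableSet {D : Set Ω} (hD : MeasurableSet[info X N hX hN n] D) :
    MeasurableSet D :=
  (info X N hX hN).le n _ hD

theorem measurableSet_aliveSet (h : Model p P X N) (hn : 1 ≤ n) (k : ℕ) :
    MeasurableSet (aliveSet X N n k) :=
  (info_measurableSet (measurableSet_info_relRank (s := Iic 2) (hX := h.measurable_X)
    (hN := h.measurable_N) hn k)).inter (h.measurableSet_le_N _)

theorem measurable_ofReal_duration (h : Model p P X N) (hn : 1 ≤ n) :
    Measurable fun ω => ENNReal.ofReal (duration X N n ω) := by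
  simp only [ofReal_duration]
  exact Measurable.tsum fun k => measurable_one.indicator (h.measurableSet_aliveSet hn k)

theorem lintegral_duration_eq_tsum (h : Model p P X N) (hn : 1 ≤ n) {D : Set Ω} :
    ∫⁻ ω in D, ENNReal.ofReal (duration X N n ω) ∂P = ∑' k, P (D ∩ aliveSet X N n k) := by
  simp only [ofReal_duration]
  rw [lintegral_tsum fun k =>
    (measurable_one.indicator (h.measurableSet_aliveSet hn k)).aemeasurable]
  refine tsum_congr fun k => ?_
  rw [lintegral_indicator_one (h.measurableSet_aliveSet hn k),
    Measure.restrict_apply (h.measurableSet_aliveSet hn k), inter_comm]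

theorem integrable_of_lintegral_ofReal_lt_top {f : Ω → ℝ} (hf0 : ∀ ω, 0 ≤ f ω)
    (hf : Measurable fun ω => ENNReal.ofReal (f ω)) (h : ∫⁻ ω, ENNReal.ofReal (f ω) ∂P < ∞) :
    Integrable f P := by
  have e : f = fun ω => (ENNReal.ofReal (f ω)).toReal :=
    funext fun ω => (ENNReal.toReal_ofReal (hf0 ω)).symm
  rw [e]
  exact integrable_toReal_of_lintegral_ne_top hf.aemeasurable h.ne

theorem integrable_duration (h : Model p P X N) (hn : 1 ≤ n) :
    Integrable (duration X N n) P := by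
  refine integrable_of_lintegral_ofReal_lt_top (duration_nonneg n)
    (h.measurable_ofReal_duration hn) ?_
  rw [← setLIntegral_univ, h.lintegral_duration_eq_tsum hn]
  calc ∑' k, P (univ ∩ aliveSet X N n k) ≤ ∑' k : ℕ, ENNReal.ofReal (1 - p) ^ k := by
        refine ENNReal.tsum_le_tsum fun k => ?_
        rw [← h.measure_succ_le k]
        refine measure_mono fun ω hω => ?_
        have : n + k + 1 ≤ N ω := hω.2.2
        rw [mem_ofPred_eq]
        omega
    _ < ∞ := by
        rw [ENNReal.tsum_geometric, ENNReal.inv_lt_top, tsub_pos_iff_lt, ENNReal.ofReal_lt_one]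
        linarith [h.pos]

variable [IsProbabilityMeasure P]

/-- Keeping rank one for another step costs a factor `q X_n`: the next object appears and is no
better. -/
theorem lintegral_relRank_eq_one (h : Model p P X N) (hn : 1 ≤ n) {D : Set Ω}
    (hD : MeasurableSet[info X N hX hN n] D) (hDm : D ⊆ {ω | IsRelMax X n ω}) (k : ℕ) :
    ∀ {φ : ℝ → ℝ≥0∞}, Measurable φ →
    ∫⁻ ω in D ∩ rankSet X n k 1 ∩ {ω | n + k ≤ N ω}, φ (X n ω) ∂P =
      ∫⁻ ω in D ∩ {ω | n ≤ N ω},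
        φ (X n ω) * (ENNReal.ofReal (1 - p) * ENNReal.ofReal (X n ω)) ^ k ∂P := by
  induction k with
  | zero =>
    intro φ _
    simp only [inter_rankSet_zero_one hDm, add_zero, pow_zero, mul_one]
  | succ k ih =>
    intro φ hφ
    have hset : D ∩ rankSet X n (k + 1) 1 =
        D ∩ rankSet X n k 1 ∩
          {ω | (X n ω, X (n + k + 1) ω) ∈ {z : ℝ × ℝ | z.2 ≤ z.1}} := by
      ext ω
      simp only [mem_inter_iff, mem_rankSet_succ_one, and_assoc]
      rfl
    have hm := (measurableSet_info_of_le hD (Nat.le_add_right n k)).inter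
      (measurableSet_info_rankSet (hX := hX) (hN := hN) hn k 1)
    have h1 := h.lintegral_step_set (hX := hX) (hN := hN) hn (Nat.le_add_right n k) hm hφ
      (B := {z : ℝ × ℝ | z.2 ≤ z.1}) (measurableSet_le measurable_snd measurable_fst)
    rw [hset]
    refine h1.trans (Eq.trans ?_ ((ih (φ := fun y => φ y *
      (ENNReal.ofReal (1 - p) * ENNReal.ofReal y)) (by fun_prop)).trans ?_))
    · refine lintegral_congr_ae (ae_restrict_of_ae ?_)
      filter_upwards [h.ae_mem_Icc] with ω hω
      have : Prod.mk (X n ω) ⁻¹' {z : ℝ × ℝ | z.2 ≤ z.1} = Iic (X n ω) := rfl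
      rw [this, unif_Iic (hω n hn)]
    · refine lintegral_congr fun ω => ?_
      ring

/-- Rank two arises from rank two and no better newcomer, or from rank one and a better newcomer.
The weights satisfy `a_{k+1} = qx a_k + (qx)^k q(1-x)` with `a_0 = 0`, since a relative maximum
starts with rank one. -/
theorem lintegral_relRank_eq_two (h : Model p P X N) (hn : 1 ≤ n) {D : Set Ω}
    (hD : MeasurableSet[info X N hX hN n] D) (hDm : D ⊆ {ω | IsRelMax X n ω}) (k : ℕ) :
    ∀ {φ : ℝ → ℝ≥0∞}, Measurable φ →
    ∫⁻ ω in D ∩ rankSet X n (k + 1) 2 ∩ {ω | n + (k + 1) ≤ N ω},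
        φ (X n ω) ∂P =
      ∫⁻ ω in D ∩ {ω | n ≤ N ω}, φ (X n ω) * ((k + 1) *
        (ENNReal.ofReal (1 - p) * ENNReal.ofReal (X n ω)) ^ k *
          (ENNReal.ofReal (1 - p) * ENNReal.ofReal (1 - X n ω))) ∂P := by
  have key : ∀ k : ℕ, ∀ {φ : ℝ → ℝ≥0∞}, Measurable φ →
      ∫⁻ ω in D ∩ rankSet X n (k + 1) 2 ∩ {ω | n + (k + 1) ≤ N ω},
        φ (X n ω) ∂P =
      ∫⁻ ω in D ∩ rankSet X n k 2 ∩ {ω | n + k ≤ N ω},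
        φ (X n ω) * (ENNReal.ofReal (1 - p) * ENNReal.ofReal (X n ω)) ∂P +
      ∫⁻ ω in D ∩ {ω | n ≤ N ω},
        φ (X n ω) * (ENNReal.ofReal (1 - p) * ENNReal.ofReal (1 - X n ω)) *
          (ENNReal.ofReal (1 - p) * ENNReal.ofReal (X n ω)) ^ k ∂P := by
    intro k φ hφ
    have hset : D ∩ rankSet X n (k + 1) 2 ∩ {ω | n + (k + 1) ≤ N ω} =
        D ∩ rankSet X n k 2 ∩
          {ω | (X n ω, X (n + k + 1) ω) ∈ {z : ℝ × ℝ | z.2 ≤ z.1}} ∩ {ω | n + k + 1 ≤ N ω} ∪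
        D ∩ rankSet X n k 1 ∩
          {ω | (X n ω, X (n + k + 1) ω) ∈ {z : ℝ × ℝ | z.1 < z.2}} ∩
            {ω | n + k + 1 ≤ N ω} := by
      ext ω
      simp only [mem_inter_iff, mem_union, mem_rankSet_succ_two, mem_ofPred_eq, ← add_assoc]
      tauto
    have hm : ∀ r, MeasurableSet[info X N hX hN (n + k)]
        (D ∩ rankSet X n k r) := fun r =>
      (measurableSet_info_of_le hD (Nat.le_add_right n k)).inter
        (measurableSet_info_rankSet (hX := hX) (hN := hN) hn k r)
    have hB1 : MeasurableSet {z : ℝ × ℝ | z.2 ≤ z.1} :=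
      measurableSet_le measurable_snd measurable_fst
    have hB2 : MeasurableSet {z : ℝ × ℝ | z.1 < z.2} :=
      measurableSet_lt measurable_fst measurable_snd
    have hpair : Measurable fun ω => (X n ω, X (n + k + 1) ω) :=
      (hX n hn).prodMk (hX _ (by omega))
    have h1 := h.lintegral_step_set (hX := hX) (hN := hN) hn (Nat.le_add_right n k) (hm 2) hφ hB1
    have h2 := h.lintegral_step_set (hX := hX) (hN := hN) hn (Nat.le_add_right n k) (hm 1) hφ hB2
    have hmeas : MeasurableSet (D ∩ rankSet X n k 1 ∩
        {ω | (X n ω, X (n + k + 1) ω) ∈ {z : ℝ × ℝ | z.1 < z.2}} ∩ {ω | n + k + 1 ≤ N ω}) :=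
      ((info_measurableSet (hm 1)).inter (hpair hB2)).inter (h.measurableSet_le_N _)
    rw [hset, lintegral_union hmeas, h1, h2]
    · congr 1
      · refine lintegral_congr_ae (ae_restrict_of_ae ?_)
        filter_upwards [h.ae_mem_Icc] with ω hω
        have : Prod.mk (X n ω) ⁻¹' {z : ℝ × ℝ | z.2 ≤ z.1} = Iic (X n ω) := rfl
        rw [this, unif_Iic (hω n hn)]
      · refine Eq.trans ?_ (h.lintegral_relRank_eq_one hn hD hDm k (φ := fun y => φ y *
          (ENNReal.ofReal (1 - p) * ENNReal.ofReal (1 - y))) (by fun_prop))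
        refine lintegral_congr_ae (ae_restrict_of_ae ?_)
        filter_upwards [h.ae_mem_Icc] with ω hω
        have : Prod.mk (X n ω) ⁻¹' {z : ℝ × ℝ | z.1 < z.2} = Ioi (X n ω) := rfl
        rw [this, unif_Ioi (hω n hn)]
    · exact (disjoint_rankSet n k).mono (fun ω hω => hω.1.1.2) fun ω hω => hω.1.1.2
  induction k with
  | zero =>
    intro φ hφ
    rw [key 0 hφ, inter_rankSet_zero_two hDm]
    simp
  | succ k ih =>
    intro φ hφ
    have hXn := hX n hn
    rw [key (k + 1) hφ, ih (φ := fun y => φ y * (ENNReal.ofReal (1 - p) * ENNReal.ofReal y))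
      (by fun_prop), ← lintegral_add_left (by fun_prop)]
    refine lintegral_congr fun ω => ?_
    push_cast
    ring

/-- The expected duration of a relative maximum, given the past. -/
theorem lintegral_duration (h : Model p P X N) (hn : 1 ≤ n) {D : Set Ω}
    (hD : MeasurableSet[info X N hX hN n] D) (hDm : D ⊆ {ω | IsRelMax X n ω}) :
    ∫⁻ ω in D, ENNReal.ofReal (duration X N n ω) ∂P =
      ∫⁻ ω in D ∩ {ω | n ≤ N ω}, ENNReal.ofReal (payoff p (X n ω)) ∂P := by
  have hXn := hX n hn
  have hmk := fun k => measurableSet_info_of_le hD (Nat.le_add_right n k)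
  have halive : ∀ k, P (D ∩ aliveSet X N n k) =
      ∫⁻ _ in D ∩ rankSet X n k 2 ∩ {ω | n + k ≤ N ω}, ENNReal.ofReal (1 - p) ∂P +
      ∫⁻ _ in D ∩ rankSet X n k 1 ∩ {ω | n + k ≤ N ω}, ENNReal.ofReal (1 - p) ∂P := by
    intro k
    -- With no condition on the new value, the step yields just the probability `1 - p` of one more
    -- object.
    have h1 := h.lintegral_step_set (hX := hX) (hN := hN) hn (Nat.le_add_right n k)
      ((hmk k).inter (measurableSet_info_relRank (s := Iic 2) hn k))
      (measurable_one (α := ℝ≥0∞)) MeasurableSet.univ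
    simp only [mem_univ, preimage_univ, measure_univ, mul_one, Pi.one_apply, one_mul,
      setLIntegral_one, ofPred_true, inter_univ] at h1
    rw [aliveSet, ← inter_assoc]
    refine h1.trans ?_
    have hset : D ∩ {ω | relRank X n (n + k) ω ∈ Iic 2} ∩ {ω | n + k ≤ N ω} =
        D ∩ rankSet X n k 2 ∩ {ω | n + k ≤ N ω} ∪ D ∩ rankSet X n k 1 ∩ {ω | n + k ≤ N ω} := by
      ext ω
      have := one_le_relRank (X := X) n (n + k) ω
      simp only [mem_inter_iff, mem_union, mem_ofPred_eq, and_assoc, ← and_or_left, mem_Iic,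
        rankSet]
      refine and_congr_right fun _ => ?_
      omega
    have hmeas : MeasurableSet (D ∩ rankSet X n k 1 ∩ {ω | n + k ≤ N ω}) :=
      (info_measurableSet ((hmk k).inter (measurableSet_info_rankSet hn k 1))).inter
        (h.measurableSet_le_N _)
    rw [hset, lintegral_union hmeas]
    exact (disjoint_rankSet n k).mono (fun ω hω => hω.1.2) fun ω hω => hω.1.2
  have h1 : ∀ k, ∫⁻ _ in D ∩ rankSet X n k 1 ∩ {ω | n + k ≤ N ω}, ENNReal.ofReal (1 - p) ∂P =
      _ := fun k =>
    h.lintegral_relRank_eq_one hn hD hDm k (measurable_const (a := ENNReal.ofReal (1 - p)))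
  have h2 : ∀ k, ∫⁻ _ in D ∩ rankSet X n (k + 1) 2 ∩ {ω | n + (k + 1) ≤ N ω},
      ENNReal.ofReal (1 - p) ∂P = _ := fun k =>
    h.lintegral_relRank_eq_two hn hD hDm k (measurable_const (a := ENNReal.ofReal (1 - p)))
  have h0 : ∫⁻ _ in D ∩ rankSet X n 0 2 ∩ {ω | n + 0 ≤ N ω}, ENNReal.ofReal (1 - p) ∂P = 0 := by
    rw [inter_rankSet_zero_two hDm, empty_inter, Measure.restrict_empty, lintegral_zero_measure]
  -- The rank-two series has no term at `k = 0`, hence the shift of its index.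
  rw [h.lintegral_duration_eq_tsum hn, tsum_congr halive, ENNReal.tsum_add,
    tsum_eq_zero_add' ENNReal.summable, h0, zero_add, tsum_congr h1, tsum_congr h2, add_comm,
    ← lintegral_tsum (fun k => by fun_prop), ← lintegral_tsum (fun k => by fun_prop),
    ← lintegral_add_left (Measurable.tsum fun k => by fun_prop)]
  refine lintegral_congr_ae (ae_restrict_of_ae ?_)
  filter_upwards [h.ae_mem_Icc] with ω hω
  exact tsum_add_tsum_eq_payoff h.pos h.lt_one (hω n hn)

/-- Since `E` is in `m`, its indicator passes through the conditional expectation, so testing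
subsets of `E` suffices. Integrability of `G` on `E` comes from the test `D = E`. -/
theorem condExp_eq_of_setLIntegral_eq {m : MeasurableSpace Ω} (hm : m ≤ mΩ) {f G : Ω → ℝ}
    (hf : Integrable f P) (hf0 : ∀ ω, 0 ≤ f ω) {E : Set Ω} (hE : MeasurableSet[m] E)
    (hG : Measurable[m] G) (hG0 : ∀ᵐ ω ∂P, 0 ≤ G ω)
    (h : ∀ D, MeasurableSet[m] D → D ⊆ E →
      ∫⁻ ω in D, ENNReal.ofReal (f ω) ∂P = ∫⁻ ω in D, ENNReal.ofReal (G ω) ∂P) :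
    ∀ᵐ ω ∂P, ω ∈ E → (P[f | m]) ω = G ω := by
  have hE' := hm _ hE
  have hGm : AEStronglyMeasurable[mΩ] G P := (hG.mono hm le_rfl).aestronglyMeasurable
  have hGi : Integrable (E.indicator G) P := by
    rw [integrable_indicator_iff hE', IntegrableOn, ← lintegral_ofReal_ne_top_iff_integrable
      hGm.restrict (ae_restrict_of_ae hG0), ← h E hE Subset.rfl]
    exact ((lintegral_ofReal_ne_top_iff_integrable hf.1.restrict
      (Filter.Eventually.of_forall hf0)).2 hf.integrableOn)
  have key : E.indicator G =ᵐ[P] P[E.indicator f | m] := by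
    refine ae_eq_condExp_of_forall_setIntegral_eq hm (hf.indicator hE')
      (fun s _ _ => hGi.integrableOn) (fun s hs _ => ?_)
      (hG.indicator hE).stronglyMeasurable.aestronglyMeasurable
    rw [setIntegral_indicator hE', setIntegral_indicator hE',
      integral_eq_lintegral_of_nonneg_ae (ae_restrict_of_ae hG0) hGm.restrict,
      integral_eq_lintegral_of_nonneg_ae (Filter.Eventually.of_forall hf0) hf.1.restrict,
      h _ (hs.inter hE) inter_subset_right]
  filter_upwards [key, condExp_indicator hf hE] with ω h1 h2 hω
  rw [h2, indicator_of_mem hω, indicator_of_mem hω] at h1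
  exact h1.symm

theorem condExp_duration (h : Model p P X N) (hn : 1 ≤ n) :
    ∀ᵐ ω ∂P, n ≤ N ω → IsRelMax X n ω →
      (P[duration X N n | info X N hX hN n]) ω = payoff p (X n ω) := by
  have := condExp_eq_of_setLIntegral_eq ((info X N hX hN).le n) (h.integrable_duration hn)
    (duration_nonneg n) (E := {ω | n ≤ N ω} ∩ {ω | IsRelMax X n ω})
    ((measurableSet_info_le hn le_rfl).inter measurableSet_info_isRelMax)
    (G := fun ω => payoff p (X n ω)) (measurable_payoff.comp (measurable_info hn le_rfl))
    (by filter_upwards [h.ae_mem_Icc] with ω hω using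
          payoff_nonneg h.pos h.lt_one (hω n hn).2)
    (fun D hD hDE => by
      rw [h.lintegral_duration hn hD fun ω hω => (hDE hω).2,
        inter_eq_left.2 fun ω hω => (hDE hω).1])
  filter_upwards [this] with ω hω h1 h2 using hω ⟨h1, h2⟩

end Model

/-! ### The time of the next relative maximum -/

section StillSet

variable {Ω : Type*} {X : ℕ → Ω → ℝ} {N : Ω → ℕ} {n : ℕ}

/-- The event that objects `n + 1, …, n + k` are all worse than the `n`-th one. -/
def stillSet (X : ℕ → Ω → ℝ) (n k : ℕ) : Set Ω :=
  {ω | ∀ j, n < j → j ≤ n + k → X j ω < X n ω}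

theorem mem_stillSet_succ {k : ℕ} {ω : Ω} :
    ω ∈ stillSet X n (k + 1) ↔ ω ∈ stillSet X n k ∧ X (n + k + 1) ω < X n ω := by
  constructor
  · exact fun h => ⟨fun j h1 h2 => h j h1 (by omega), h _ (by omega) (by omega)⟩
  · rintro ⟨h1, h2⟩ j hj1 hj2
    rcases Nat.lt_or_ge (n + k) j with h | h
    · rwa [show j = n + k + 1 by omega]
    · exact h1 j hj1 h

/-- A later value that is not a relative maximum lies strictly below an earlier one, and strong
induction traces this back to `X n`. Ties count as relative maxima, hence the strict inequality in
`stillSet`. -/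
theorem nextRelMax_eq_iff_stillSet {ω : Ω} (hn : 1 ≤ n) (hm : IsRelMax X n ω) (k : ℕ) :
    nextRelMax X N n ω = ((n + k + 1 : ℕ) : WithTop ℕ) ↔
      X n ω ≤ X (n + k + 1) ω ∧ ω ∈ stillSet X n k ∧ n + k + 1 ≤ N ω := by
  rw [nextRelMax_eq_coe_iff]
  constructor
  · rintro ⟨⟨-, hN, hrel⟩, hnot⟩
    refine ⟨hrel n hn (by omega), fun j => ?_, hN⟩
    induction j using Nat.strong_induction_on with
    | _ j ih =>
      intro h1 h2
      have hj : ¬ IsRelMax X j ω := fun hj => hnot j (by omega) ⟨h1, by omega, hj⟩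
      rw [IsRelMax] at hj
      push Not at hj
      obtain ⟨i, hi1, hi2, hi⟩ := hj
      rcases Nat.lt_or_ge n i with hni | hni
      · rcases eq_or_lt_of_le hi2 with rfl | hlt
        · exact absurd hi (lt_irrefl _)
        · exact hi.trans (ih i hlt hni (by omega))
      · exact hi.trans_le (hm i hi1 hni)
  · rintro ⟨hle, hst, hN⟩
    refine ⟨⟨by omega, hN, fun j h1 h2 => ?_⟩, fun j hj ⟨h1, _, hrel⟩ => ?_⟩
    · rcases Nat.lt_or_ge n j with h | h
      · rcases eq_or_lt_of_le h2 with rfl | hlt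
        · exact le_rfl
        · exact (hst j h (by omega)).le.trans hle
      · exact (hm j h1 h).trans hle
    · exact absurd (hrel n hn (by omega)) (not_le.2 (hst j h1 (by omega)))

end StillSet

namespace Model

variable {Ω : Type*} [mΩ : MeasurableSpace Ω] {p : ℝ} {P : Measure Ω}
  {X : ℕ → Ω → ℝ} {N : Ω → ℕ} {hX : ∀ k, 1 ≤ k → Measurable (X k)} {hN : Measurable N} {n : ℕ}

/-! ### The reward of an admissible rule -/

section Reward

variable {τ : Ω → WithTop ℕ}

theorem ne_zero_of_admissible (hτ : Admissible X N hX hN τ) (ω : Ω) : τ ω ≠ 0 := fun h0 =>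
  absurd (hτ.2 ω 0 h0).1 (by omega)

theorem measurable_ofReal_reward (h : Model p P X N) (hτ : Admissible X N hX hN τ) :
    Measurable fun ω => ENNReal.ofReal (reward X N τ ω) := by
  simp only [fun ω => ofReal_reward (X := X) (N := N) (ne_zero_of_admissible hτ ω)]
  exact Measurable.tsum fun m => (h.measurable_ofReal_duration (by omega)).indicator
    (info_measurableSet (hτ.1.measurableSet_eq (m + 1)))

/-- An admissible rule stops only at relative maxima that appear, so the duration may be replaced by
its conditional mean. The reward, which depends on the future, becomes a payoff known when stopping.
-/
theorem lintegral_reward [IsProbabilityMeasure P] (h : Model p P X N)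
    (hτ : Admissible X N hX hN τ) {D : Set Ω}
    (hD : ∀ m : ℕ, MeasurableSet[info X N hX hN (m + 1)]
      (D ∩ {ω | τ ω = ((m + 1 : ℕ) : WithTop ℕ)})) :
    ∫⁻ ω in D, ENNReal.ofReal (reward X N τ ω) ∂P =
      ∑' m : ℕ, ∫⁻ ω in D ∩ {ω | τ ω = ((m + 1 : ℕ) : WithTop ℕ)},
        ENNReal.ofReal (payoff p (X (m + 1) ω)) ∂P := by
  have hm : ∀ m : ℕ, MeasurableSet {ω | τ ω = ((m + 1 : ℕ) : WithTop ℕ)} := fun m =>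
    info_measurableSet (hτ.1.measurableSet_eq (m + 1))
  simp only [fun ω => ofReal_reward (X := X) (N := N) (ne_zero_of_admissible hτ ω)]
  rw [lintegral_tsum fun m =>
    ((h.measurable_ofReal_duration (by omega)).indicator (hm m)).aemeasurable]
  refine tsum_congr fun m => ?_
  rw [setLIntegral_indicator (hm m), inter_comm, h.lintegral_duration (by omega) (hD m)
    fun ω hω => (hτ.2 ω _ hω.2).2.2, inter_eq_left.2 (show _ ⊆ {ω | m + 1 ≤ N ω} from fun ω hω => (hτ.2 ω _ hω.2).2.1)]

end Reward

theorem admissible_nextRelMax (n : ℕ) : Admissible X N hX hN (nextRelMax X N n) := by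
  refine ⟨isStoppingTime_of_measurableSet_eq fun m => ?_, fun ω m hm => ?_⟩
  · have hQ : ∀ j ≤ m, MeasurableSet[info X N hX hN m]
        {ω | n < j ∧ j ≤ N ω ∧ IsRelMax X j ω} := fun j hj => by
      by_cases hnj : n < j
      · simp only [hnj, true_and]
        exact (measurableSet_info_le (by omega) hj).inter
          (measurableSet_info_of_le measurableSet_info_isRelMax hj)
      · simp only [hnj, false_and, ofPred_false, MeasurableSet.empty]
    have hm : MeasurableSet[info X N hX hN m] {ω | nextRelMax X N n ω = (m : WithTop ℕ)} := by
      have : {ω | nextRelMax X N n ω = (m : WithTop ℕ)} =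
          {ω | n < m ∧ m ≤ N ω ∧ IsRelMax X m ω} ∩
            ⋂ j ∈ Iio m, {ω | n < j ∧ j ≤ N ω ∧ IsRelMax X j ω}ᶜ := by
        ext ω
        simp only [mem_ofPred_eq, nextRelMax_eq_coe_iff, mem_inter_iff, mem_iInter, mem_Iio,
          mem_compl_iff]
      rw [this]
      exact (hQ m le_rfl).inter (MeasurableSet.biInter (to_countable _) fun j hj =>
        (hQ j (le_of_lt hj)).compl)
    exact hm
  · rw [nextRelMax_eq_coe_iff] at hm
    exact ⟨by omega, hm.1.2⟩

theorem admissible_firstRelMaxIn {S : Set ℝ} (hS : MeasurableSet S) :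
    Admissible X N hX hN (firstRelMaxIn X N S) := by
  refine ⟨isStoppingTime_of_measurableSet_eq fun m => ?_, fun ω m hm => ?_⟩
  · have hQ : ∀ j ≤ m, MeasurableSet[info X N hX hN m]
        {ω | 1 ≤ j ∧ j ≤ N ω ∧ IsRelMax X j ω ∧ X j ω ∈ S} := fun j hj => by
      by_cases hj1 : 1 ≤ j
      · simp only [hj1, true_and]
        exact (measurableSet_info_le (by omega) hj).inter
          ((measurableSet_info_of_le measurableSet_info_isRelMax hj).inter
            (measurable_info hj1 hj hS))
      · simp only [hj1, false_and, ofPred_false, MeasurableSet.empty]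
    have hm : MeasurableSet[info X N hX hN m] {ω | firstRelMaxIn X N S ω = (m : WithTop ℕ)} := by
      have : {ω | firstRelMaxIn X N S ω = (m : WithTop ℕ)} =
          {ω | 1 ≤ m ∧ m ≤ N ω ∧ IsRelMax X m ω ∧ X m ω ∈ S} ∩
            ⋂ j ∈ Iio m, {ω | 1 ≤ j ∧ j ≤ N ω ∧ IsRelMax X j ω ∧ X j ω ∈ S}ᶜ := by
        ext ω
        simp only [mem_ofPred_eq, firstRelMaxIn_eq_coe_iff, mem_inter_iff, mem_iInter, mem_Iio,
          mem_compl_iff]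
      rw [this]
      exact (hQ m le_rfl).inter (MeasurableSet.biInter (to_countable _) fun j hj =>
        (hQ j (le_of_lt hj)).compl)
    exact hm
  · rw [firstRelMaxIn_eq_coe_iff] at hm
    exact ⟨hm.1.1, hm.1.2.1, hm.1.2.2.1⟩

/-! ### Passing to the next relative maximum -/

theorem measurableSet_info_stillSet (hn : 1 ≤ n) (k : ℕ) :
    MeasurableSet[info X N hX hN (n + k)] (stillSet X n k) := by
  have key : ∀ {m : MeasurableSpace Ω}, (∀ j, 1 ≤ j → j ≤ n + k → Measurable (X j)) →
      MeasurableSet (stillSet X n k) := by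
    intro m hm
    have : stillSet X n k = ⋂ j ∈ Ioc n (n + k), {ω | X j ω < X n ω} := by
      ext ω
      simp [stillSet]
    rw [this]
    exact MeasurableSet.biInter (to_countable _) fun j hj =>
      measurableSet_lt (hm j (hn.trans (le_of_lt hj.1)) hj.2) (hm n hn (by omega))
  exact key (m := info X N hX hN (n + k)) fun j h1 h2 => measurable_info h1 h2

variable [IsProbabilityMeasure P]

theorem lintegral_stillSet (h : Model p P X N) (hn : 1 ≤ n) {D : Set Ω}
    (hD : MeasurableSet[info X N hX hN n] D) (k : ℕ) :
    ∀ {φ : ℝ → ℝ≥0∞}, Measurable φ →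
    ∫⁻ ω in D ∩ stillSet X n k ∩ {ω | n + k ≤ N ω}, φ (X n ω) ∂P =
      ∫⁻ ω in D ∩ {ω | n ≤ N ω},
        φ (X n ω) * (ENNReal.ofReal (1 - p) * ENNReal.ofReal (X n ω)) ^ k ∂P := by
  induction k with
  | zero =>
    intro φ _
    have : D ∩ stillSet X n 0 = D := inter_eq_left.2 fun ω _ j h1 h2 => by omega
    simp only [this, add_zero, pow_zero, mul_one]
  | succ k ih =>
    intro φ hφ
    have hset : D ∩ stillSet X n (k + 1) =
        D ∩ stillSet X n k ∩ {ω | (X n ω, X (n + k + 1) ω) ∈ {z : ℝ × ℝ | z.2 < z.1}} := by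
      ext ω
      simp only [mem_inter_iff, mem_stillSet_succ, and_assoc]
      rfl
    have hm := (measurableSet_info_of_le hD (Nat.le_add_right n k)).inter
      (measurableSet_info_stillSet (hX := hX) (hN := hN) hn k)
    have h1 := h.lintegral_step_set (hX := hX) (hN := hN) hn (Nat.le_add_right n k) hm hφ
      (B := {z : ℝ × ℝ | z.2 < z.1}) (measurableSet_lt measurable_snd measurable_fst)
    rw [hset]
    refine h1.trans (Eq.trans ?_ ((ih (φ := fun y => φ y *
      (ENNReal.ofReal (1 - p) * ENNReal.ofReal y)) (by fun_prop)).trans ?_))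
    · refine lintegral_congr_ae (ae_restrict_of_ae ?_)
      filter_upwards [h.ae_mem_Icc] with ω hω
      have : Prod.mk (X n ω) ⁻¹' {z : ℝ × ℝ | z.2 < z.1} = Iio (X n ω) := rfl
      rw [this, unif_Iio (hω n hn)]
    · refine lintegral_congr fun ω => ?_
      ring

theorem tsum_eq_nextPayoffClosed (hp0 : 0 < p) (hp1 : p < 1) {y : ℝ} (hy : y ∈ Icc (0 : ℝ) 1) :
    ∑' k : ℕ, ENNReal.ofReal (1 - p) *
        ENNReal.ofReal (2 * Real.log ((1 - (1 - p) * y) / p) + p / (1 - (1 - p) * y) - 1) *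
        (ENNReal.ofReal (1 - p) * ENNReal.ofReal y) ^ k = ENNReal.ofReal (nextPayoffClosed p y) := by
  have hq : 0 ≤ 1 - p := by linarith
  have hr : 0 ≤ (1 - p) * y := mul_nonneg hq hy.1
  have hr1 : (1 - p) * y < 1 := by nlinarith [hy.2]
  have hI := integral_payoff_nonneg hp0 hp1 hy.2
  rw [integral_payoff hp0 hp1 hy.2] at hI
  rw [nextPayoffClosed]
  generalize 2 * Real.log ((1 - (1 - p) * y) / p) + p / (1 - (1 - p) * y) - 1 = I at hI ⊢
  have e : ∀ k : ℕ, ENNReal.ofReal (1 - p) * ENNReal.ofReal I *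
      (ENNReal.ofReal (1 - p) * ENNReal.ofReal y) ^ k =
        ENNReal.ofReal ((1 - p) * I * ((1 - p) * y) ^ k) := fun k => by
    rw [ENNReal.ofReal_mul (by positivity), ENNReal.ofReal_mul hq, ENNReal.ofReal_pow hr,
      ENNReal.ofReal_mul hq]
  simp only [e]
  rw [← ENNReal.ofReal_tsum_of_nonneg (fun k => by positivity)
      ((summable_geometric_of_lt_one hr hr1).mul_left _), tsum_mul_left,
    tsum_geometric_of_lt_one hr hr1]
  congr 1
  ring

/-- The expected reward of waiting for the next relative maximum, given the past. -/
theorem lintegral_reward_nextRelMax (h : Model p P X N) (hn : 1 ≤ n) {D : Set Ω}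
    (hD : MeasurableSet[info X N hX hN n] D) (hDm : D ⊆ {ω | IsRelMax X n ω})
    (hDN : D ⊆ {ω | n ≤ N ω}) :
    ∫⁻ ω in D, ENNReal.ofReal (reward X N (nextRelMax X N n) ω) ∂P =
      ∫⁻ ω in D, ENNReal.ofReal (nextPayoffClosed p (X n ω)) ∂P := by
  have hτ := admissible_nextRelMax (X := X) (N := N) (hX := hX) (hN := hN) n
  have hlow : ∀ m < n, D ∩ {ω | nextRelMax X N n ω = ((m + 1 : ℕ) : WithTop ℕ)} = ∅ := by
    intro m hm
    refine eq_empty_of_forall_notMem fun ω hω => ?_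
    have h2 := hω.2
    rw [mem_ofPred_eq, nextRelMax_eq_coe_iff] at h2
    omega
  rw [h.lintegral_reward hτ, ← Summable.sum_add_tsum_nat_add' (k := n) ENNReal.summable,
    Finset.sum_eq_zero, zero_add]
  · have hmpay := measurable_payoff (p := p)
    have key : ∀ k : ℕ, ∫⁻ ω in D ∩
        {ω | nextRelMax X N n ω = ((k + n + 1 : ℕ) : WithTop ℕ)},
          ENNReal.ofReal (payoff p (X (k + n + 1) ω)) ∂P =
        ∫⁻ ω in D, ENNReal.ofReal (1 - p) *
          ENNReal.ofReal (2 * Real.log ((1 - (1 - p) * X n ω) / p) +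
            p / (1 - (1 - p) * X n ω) - 1) *
          (ENNReal.ofReal (1 - p) * ENNReal.ofReal (X n ω)) ^ k ∂P := by
      intro k
      have hset : D ∩ {ω | nextRelMax X N n ω = ((n + k + 1 : ℕ) : WithTop ℕ)} =
          {ω | X n ω ≤ X (n + k + 1) ω} ∩ (D ∩ stillSet X n k ∩ {ω | n + k + 1 ≤ N ω}) := by
        ext ω
        by_cases hω : ω ∈ D
        · simp only [mem_inter_iff, hω, mem_ofPred_eq, nextRelMax_eq_iff_stillSet hn (hDm hω),
            true_and]
        · simp only [mem_inter_iff, hω, false_and, and_false]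
      have hle : MeasurableSet {ω | X n ω ≤ X (n + k + 1) ω} :=
        measurableSet_le (hX n hn) (hX _ (by omega))
      have hm := (measurableSet_info_of_le hD (Nat.le_add_right n k)).inter
        (measurableSet_info_stillSet (hX := hX) (hN := hN) hn k)
      have hH : Measurable (Function.uncurry fun y v : ℝ =>
          if y ≤ v then ENNReal.ofReal (payoff p v) else 0) :=
        Measurable.ite (measurableSet_le measurable_fst measurable_snd)
          (hmpay.comp measurable_snd).ennreal_ofReal measurable_const
      rw [add_comm k n, hset, ← setLIntegral_indicator hle]
      -- First integrate out the value of the new maximum, then the `k` values that stayed below `X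
      -- n`.
      refine Eq.trans ?_ ((h.lintegral_step (hX := hX) (hN := hN) (by omega) hm
        (measurable_past hn (Nat.le_add_right n k)) hH).trans ?_)
      · rfl
      · have := h.lintegral_stillSet hn hD k (φ := fun y => ENNReal.ofReal (1 - p) *
          ENNReal.ofReal (2 * Real.log ((1 - (1 - p) * y) / p) + p / (1 - (1 - p) * y) - 1))
          (by fun_prop)
        rw [inter_eq_left.2 hDN] at this
        refine Eq.trans ?_ this
        refine lintegral_congr_ae (ae_restrict_of_ae ?_)
        filter_upwards [h.ae_mem_Icc] with ω hω
        rw [lintegral_unif_ite (hω n hn)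
          (intervalIntegrable_payoff h.pos h.lt_one (hω n hn).2 le_rfl)
          (fun v hv => payoff_nonneg h.pos h.lt_one hv), zero_mul, add_zero,
          integral_payoff h.pos h.lt_one (hω n hn).2]
    have hXn := hX n hn
    rw [tsum_congr key, ← lintegral_tsum (fun k => by fun_prop)]
    refine lintegral_congr_ae (ae_restrict_of_ae ?_)
    filter_upwards [h.ae_mem_Icc] with ω hω
    exact tsum_eq_nextPayoffClosed h.pos h.lt_one (hω n hn)
  · intro m hm
    rw [hlow m (Finset.mem_range.1 hm), Measure.restrict_empty, lintegral_zero_measure]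
  · intro m
    rcases Nat.lt_or_ge m n with hm | hm
    · rw [hlow m hm]
      exact @MeasurableSet.empty _ (info X N hX hN (m + 1))
    · exact (measurableSet_info_of_le hD (by omega)).inter (hτ.1.measurableSet_eq (m + 1))

theorem condExp_reward_nextRelMax (h : Model p P X N) (hn : 1 ≤ n)
    (hint : Integrable (reward X N (nextRelMax X N n)) P) :
    ∀ᵐ ω ∂P, n ≤ N ω → IsRelMax X n ω →
      (P[reward X N (nextRelMax X N n) | info X N hX hN n]) ω = nextPayoff p (X n ω) := by
  have := condExp_eq_of_setLIntegral_eq ((info X N hX hN).le n) hint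
    (reward_nonneg _) (E := {ω | n ≤ N ω} ∩ {ω | IsRelMax X n ω})
    ((measurableSet_info_le hn le_rfl).inter measurableSet_info_isRelMax)
    (G := fun ω => nextPayoffClosed p (X n ω))
    (measurable_nextPayoffClosed.comp (measurable_info hn le_rfl))
    (by filter_upwards [h.ae_mem_Icc] with ω hω
        rw [← nextPayoff_eq_closed h.pos h.lt_one (hω n hn).1 (hω n hn).2]
        exact nextPayoff_nonneg h.pos h.lt_one (hω n hn).1 (hω n hn).2)
    (fun D hD hDE => h.lintegral_reward_nextRelMax hn hD (fun ω hω => (hDE hω).2)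
      fun ω hω => (hDE hω).1)
  filter_upwards [this, h.ae_mem_Icc] with ω hω hmem h1 h2
  rw [hω ⟨h1, h2⟩, nextPayoff_eq_closed h.pos h.lt_one (hmem n hn).1 (hmem n hn).2]

end Model

/-! ### Optimality -/

section StepValue

variable {Ω : Type*} {p s : ℝ} {X : ℕ → Ω → ℝ} {n : ℕ}

/-- The value, after a new observation `v`, of the best of stopping and continuing when the best
previous value is `m`. -/
noncomputable def stepValue (p s m v : ℝ) : ℝ≥0∞ :=
  if m ≤ v then ENNReal.ofReal (stopValue p s v) else ENNReal.ofReal (contValue p s m)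

theorem measurable_stepValue : Measurable (Function.uncurry (stepValue p s)) :=
  Measurable.ite (measurableSet_le measurable_fst measurable_snd)
    (measurable_stopValue.comp measurable_snd).ennreal_ofReal
    (measurable_contValue.comp measurable_fst).ennreal_ofReal

theorem stopValue_nonneg (hp0 : 0 < p) (hp1 : p < 1) {v : ℝ} (hv : v ≤ 1) :
    0 ≤ stopValue p s v :=
  (payoff_nonneg hp0 hp1 hv).trans (le_max_left _ _)

/-- The optimality equation `contValue_fixed`, read as an expectation over the next object. -/
theorem lintegral_stepValue (hp0 : 0 < p) (hp1 : p < 1) (hs : IsThreshold p s) {m : ℝ}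
    (hm : m ∈ Icc (0 : ℝ) 1) :
    ENNReal.ofReal (1 - p) * ∫⁻ v, stepValue p s m v ∂unif = ENNReal.ofReal (contValue p s m) := by
  obtain ⟨hi, he⟩ := contValue_fixed hp0 hp1 hs hm.1 hm.2
  have h0 := contValue_nonneg hp0 hp1 hs.nonneg hs.lt_one.le hm.2
  have hI : 0 ≤ ∫ v in m..1, stopValue p s v :=
    intervalIntegral.integral_nonneg hm.2 fun v hv => stopValue_nonneg hp0 hp1 hv.2
  simp only [stepValue]
  rw [lintegral_unif_ite hm hi (fun v hv => stopValue_nonneg hp0 hp1 hv), ← ENNReal.ofReal_mul h0,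
    ← ENNReal.ofReal_add hI (mul_nonneg h0 hm.1), ← ENNReal.ofReal_mul (by linarith)]
  congr 1
  linear_combination -he

theorem lintegral_stopValue_lt_top (hp0 : 0 < p) (hp1 : p < 1) (hs : IsThreshold p s) :
    ∫⁻ v, ENNReal.ofReal (stopValue p s v) ∂unif < ∞ := by
  obtain ⟨hi, -⟩ := contValue_fixed hp0 hp1 hs le_rfl zero_le_one
  have := ((intervalIntegrable_iff_integrableOn_Icc_of_le zero_le_one).1 hi).2
  exact (hasFiniteIntegral_iff_ofReal ((ae_restrict_iff' measurableSet_Icc).2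
    (Filter.Eventually.of_forall fun v hv => stopValue_nonneg hp0 hp1 hv.2))).1 this

theorem coe_lt_iff_eq_or_lt (a : WithTop ℕ) (n : ℕ) :
    (n : WithTop ℕ) < a ↔ a = ((n + 1 : ℕ) : WithTop ℕ) ∨ ((n + 1 : ℕ) : WithTop ℕ) < a := by
  induction a using WithTop.recTopCoe with
  | top => exact iff_of_true (WithTop.coe_lt_top n) (Or.inr (WithTop.coe_lt_top (n + 1)))
  | coe m =>
    refine WithTop.coe_lt_coe.trans (Iff.trans ?_
      (or_congr WithTop.coe_inj WithTop.coe_lt_coe).symm)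
    change n < m ↔ m = n + 1 ∨ n + 1 < m
    omega

theorem le_stepValue_of_isRelMax {ω : Ω} (hm : IsRelMax X (n + 1) ω) :
    ENNReal.ofReal (payoff p (X (n + 1) ω)) ≤ stepValue p s (runMax X n ω) (X (n + 1) ω) := by
  rw [stepValue, if_pos ((isRelMax_succ_iff n).1 hm)]
  exact ENNReal.ofReal_le_ofReal (le_max_left _ _)

theorem contValue_runMax_le (n : ℕ) (ω : Ω) :
    ENNReal.ofReal (contValue p s (runMax X (n + 1) ω)) ≤
      stepValue p s (runMax X n ω) (X (n + 1) ω) := by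
  rw [stepValue, runMax]
  split_ifs with h
  · rw [max_eq_right h]
    exact ENNReal.ofReal_le_ofReal (le_max_right _ _)
  · rw [max_eq_left (not_le.1 h).le]

end StepValue

namespace Model

variable {Ω : Type*} [mΩ : MeasurableSpace Ω] {p s : ℝ} {P : Measure Ω}
  {X : ℕ → Ω → ℝ} {N : Ω → ℕ} {hX : ∀ k, 1 ≤ k → Measurable (X k)} {hN : Measurable N} {n : ℕ}
  {τ : Ω → WithTop ℕ}

theorem lt_inter_le_eq_union (hτ : Admissible X N hX hN τ) (n : ℕ) :
    {ω | (n : WithTop ℕ) < τ ω} ∩ {ω | n + 1 ≤ N ω} =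
      {ω | τ ω = ((n + 1 : ℕ) : WithTop ℕ)} ∪
        ({ω | ((n + 1 : ℕ) : WithTop ℕ) < τ ω} ∩ {ω | n + 1 ≤ N ω}) := by
  ext ω
  simp only [mem_inter_iff, mem_union, mem_ofPred_eq, coe_lt_iff_eq_or_lt (τ ω) n]
  have := fun e => (hτ.2 ω (n + 1) e).2.1
  tauto

theorem lintegral_lt_eq_add (h : Model p P X N) (hτ : Admissible X N hX hN τ) (n : ℕ)
    (f : Ω → ℝ≥0∞) :
    ∫⁻ ω in {ω | (n : WithTop ℕ) < τ ω} ∩ {ω | n + 1 ≤ N ω}, f ω ∂P =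
      ∫⁻ ω in {ω | τ ω = ((n + 1 : ℕ) : WithTop ℕ)}, f ω ∂P +
      ∫⁻ ω in {ω | ((n + 1 : ℕ) : WithTop ℕ) < τ ω} ∩ {ω | n + 1 ≤ N ω}, f ω ∂P := by
  have hm : MeasurableSet ({ω | ((n + 1 : ℕ) : WithTop ℕ) < τ ω} ∩ {ω | n + 1 ≤ N ω}) :=
    (info_measurableSet (hτ.1.measurableSet_gt (n + 1))).inter (h.measurableSet_le_N _)
  rw [lt_inter_le_eq_union hτ, lintegral_union hm]
  rw [disjoint_left]
  rintro ω h1 ⟨h2, -⟩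
  rw [mem_ofPred_eq] at h1 h2
  exact h2.ne' h1

/-- The expected reward collected up to time `n`, plus the value of continuing optimally after
time `n`. -/
noncomputable def gain (P : Measure Ω) (p s : ℝ) (X : ℕ → Ω → ℝ) (N : Ω → ℕ) (τ : Ω → WithTop ℕ)
    (n : ℕ) : ℝ≥0∞ :=
  ∑ m ∈ Finset.range n, ∫⁻ ω in {ω | τ ω = ((m + 1 : ℕ) : WithTop ℕ)},
      ENNReal.ofReal (payoff p (X (m + 1) ω)) ∂P +
    ∫⁻ ω in {ω | (n : WithTop ℕ) < τ ω} ∩ {ω | n ≤ N ω},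
      ENNReal.ofReal (contValue p s (runMax X n ω)) ∂P

/-- Stopping and continuing are each dominated by the better of the two, which is what `stepValue`
records. -/
theorem one_step_le (h : Model p P X N) (hτ : Admissible X N hX hN τ) (n : ℕ) :
    ∫⁻ ω in {ω | τ ω = ((n + 1 : ℕ) : WithTop ℕ)},
        ENNReal.ofReal (payoff p (X (n + 1) ω)) ∂P +
      ∫⁻ ω in {ω | ((n + 1 : ℕ) : WithTop ℕ) < τ ω} ∩ {ω | n + 1 ≤ N ω},
        ENNReal.ofReal (contValue p s (runMax X (n + 1) ω)) ∂P ≤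
    ∫⁻ ω in {ω | (n : WithTop ℕ) < τ ω} ∩ {ω | n + 1 ≤ N ω},
      stepValue p s (runMax X n ω) (X (n + 1) ω) ∂P := by
  rw [h.lintegral_lt_eq_add hτ]
  refine add_le_add (setLIntegral_mono' (info_measurableSet (hτ.1.measurableSet_eq (n + 1)))
    fun ω hω => le_stepValue_of_isRelMax (hτ.2 ω (n + 1) hω).2.2)
    (lintegral_mono fun ω => contValue_runMax_le n ω)

/-- The look-ahead rule always takes the better option: it stops at values at least `s`, where the
payoff attains the maximum, and passes over relative maxima below `s`, where continuing does. -/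
theorem one_step_eq (h : Model p P X N) (hs : IsThreshold p s)
    (hτ : Admissible X N hX hN (firstRelMaxIn X N (lookAheadSet p))) (n : ℕ) :
    ∫⁻ ω in {ω | firstRelMaxIn X N (lookAheadSet p) ω = ((n + 1 : ℕ) : WithTop ℕ)},
        ENNReal.ofReal (payoff p (X (n + 1) ω)) ∂P +
      ∫⁻ ω in {ω | ((n + 1 : ℕ) : WithTop ℕ) < firstRelMaxIn X N (lookAheadSet p) ω} ∩
          {ω | n + 1 ≤ N ω},
        ENNReal.ofReal (contValue p s (runMax X (n + 1) ω)) ∂P =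
    ∫⁻ ω in {ω | (n : WithTop ℕ) < firstRelMaxIn X N (lookAheadSet p) ω} ∩
        {ω | n + 1 ≤ N ω},
      stepValue p s (runMax X n ω) (X (n + 1) ω) ∂P := by
  rw [h.lintegral_lt_eq_add hτ]
  congr 1
  · refine setLIntegral_congr_fun (info_measurableSet (hτ.1.measurableSet_eq (n + 1)))
      fun ω hω => ?_
    have h1 := (firstRelMaxIn_eq_coe_iff _).1 hω
    have hB := hs.lookAheadSet_eq.le h1.1.2.2.2
    rw [stepValue, if_pos ((isRelMax_succ_iff n).1 h1.1.2.2.1),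
      stopValue_of_le h.pos h.lt_one hs hB.2 hB.1.2]
  · have hm : MeasurableSet ({ω | ((n + 1 : ℕ) : WithTop ℕ) <
        firstRelMaxIn X N (lookAheadSet p) ω} ∩ {ω | n + 1 ≤ N ω}) :=
      (info_measurableSet (hτ.1.measurableSet_gt (n + 1))).inter (h.measurableSet_le_N _)
    refine lintegral_congr_ae ((ae_restrict_iff' hm).2 ?_)
    filter_upwards [h.ae_mem_Icc] with ω hmem ⟨hlt, hle⟩
    rw [stepValue, runMax]
    split_ifs with hmax
    · rw [max_eq_right hmax]
      have hX1 := hmem (n + 1) (by omega)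
      have hnot : X (n + 1) ω ∉ lookAheadSet p := fun hin => by
        have hQ : 1 ≤ n + 1 ∧ n + 1 ≤ N ω ∧ IsRelMax X (n + 1) ω ∧
            X (n + 1) ω ∈ lookAheadSet p := ⟨by omega, hle, (isRelMax_succ_iff n).2 hmax, hin⟩
        exact absurd hlt (not_lt.2 (firstRelMaxIn_le hQ))
      have hlts : X (n + 1) ω < s := by
        by_contra! hge
        exact hnot (hs.lookAheadSet_eq.ge ⟨hX1, hge⟩)
      rw [stopValue_of_lt h.pos h.lt_one hs hlts hX1.1, contValue, contValue, max_eq_right hlts.le,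
        max_self]
    · rw [max_eq_left (not_le.1 hmax).le]

variable [IsProbabilityMeasure P]

/-- Averaging over the next object gives back the continuation term of `gain`, which links
consecutive times. -/
theorem lintegral_stepValue_succ (h : Model p P X N) (hs : IsThreshold p s)
    (hτ : Admissible X N hX hN τ) (n : ℕ) :
    ∫⁻ ω in {ω | ((n + 1 : ℕ) : WithTop ℕ) < τ ω} ∩ {ω | n + 1 + 1 ≤ N ω},
      stepValue p s (runMax X (n + 1) ω) (X (n + 1 + 1) ω) ∂P =
    ∫⁻ ω in {ω | ((n + 1 : ℕ) : WithTop ℕ) < τ ω} ∩ {ω | n + 1 ≤ N ω},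
      ENNReal.ofReal (contValue p s (runMax X (n + 1) ω)) ∂P := by
  refine (h.lintegral_step (hX := hX) (hN := hN) (n := n + 1) (by omega)
    (hτ.1.measurableSet_gt (n + 1))
    (measurable_runMax (m := past X (n + 1)) (fun k h1 h2 => measurable_past h1 h2) n le_rfl)
    measurable_stepValue).trans ?_
  refine lintegral_congr_ae (ae_restrict_of_ae ?_)
  filter_upwards [h.ae_mem_Icc] with ω hω
  exact lintegral_stepValue h.pos h.lt_one hs (runMax_mem_Icc hω _)

/-- The first object appears almost surely, so no factor `1 - p` enters, and it is compared with
itself, so the branch `m ≤ v` applies. -/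
theorem lintegral_stepValue_zero (h : Model p P X N) (hτ : Admissible X N hX hN τ) :
    ∫⁻ ω in {ω | ((0 : ℕ) : WithTop ℕ) < τ ω} ∩ {ω | 0 + 1 ≤ N ω},
      stepValue p s (runMax X 0 ω) (X (0 + 1) ω) ∂P =
    ∫⁻ v, ENNReal.ofReal (stopValue p s v) ∂unif := by
  have hset : ({ω | ((0 : ℕ) : WithTop ℕ) < τ ω} ∩ {ω | 0 + 1 ≤ N ω} : Set Ω) =ᵐ[P] univ := by
    rw [Filter.eventuallyEq_univ]
    filter_upwards [h.ae_one_le] with ω hω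
    exact ⟨pos_iff_ne_zero.2 (ne_zero_of_admissible hτ ω), hω⟩
  rw [setLIntegral_congr hset, setLIntegral_univ, unif, ← h.map_X 1 le_rfl,
    lintegral_map measurable_stopValue.ennreal_ofReal (h.measurable_X 1 le_rfl)]
  refine lintegral_congr fun ω => ?_
  exact if_pos le_rfl

theorem gain_one_le (h : Model p P X N) (hτ : Admissible X N hX hN τ) :
    gain P p s X N τ 1 ≤ ∫⁻ v, ENNReal.ofReal (stopValue p s v) ∂unif := by
  rw [← h.lintegral_stepValue_zero hτ, gain, Finset.sum_range_one]
  exact h.one_step_le hτ 0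

theorem gain_succ_le (h : Model p P X N) (hs : IsThreshold p s) (hτ : Admissible X N hX hN τ)
    (n : ℕ) : gain P p s X N τ (n + 1) ≤ ∫⁻ v, ENNReal.ofReal (stopValue p s v) ∂unif := by
  induction n with
  | zero => exact h.gain_one_le hτ
  | succ n ih =>
    refine le_trans ?_ ih
    rw [gain, gain, Finset.sum_range_succ, add_assoc]
    gcongr
    rw [← h.lintegral_stepValue_succ hs hτ n]
    exact h.one_step_le hτ (n + 1)

theorem gain_succ_eq (h : Model p P X N) (hs : IsThreshold p s)
    (hτ : Admissible X N hX hN (firstRelMaxIn X N (lookAheadSet p))) (n : ℕ) :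
    gain P p s X N (firstRelMaxIn X N (lookAheadSet p)) (n + 1) =
      ∫⁻ v, ENNReal.ofReal (stopValue p s v) ∂unif := by
  induction n with
  | zero =>
    rw [← h.lintegral_stepValue_zero hτ, gain, Finset.sum_range_one]
    exact h.one_step_eq hs hτ 0
  | succ n ih =>
    rw [← ih, gain, gain, Finset.sum_range_succ, add_assoc]
    congr 1
    rw [← h.lintegral_stepValue_succ hs hτ n]
    exact h.one_step_eq hs hτ (n + 1)

theorem lintegral_reward_eq_tsum (h : Model p P X N) (hτ : Admissible X N hX hN τ) :
    ∫⁻ ω, ENNReal.ofReal (reward X N τ ω) ∂P =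
      ∑' m : ℕ, ∫⁻ ω in {ω | τ ω = ((m + 1 : ℕ) : WithTop ℕ)},
        ENNReal.ofReal (payoff p (X (m + 1) ω)) ∂P := by
  rw [← setLIntegral_univ, h.lintegral_reward hτ]
  · simp only [univ_inter]
  · intro m
    rw [univ_inter]
    exact hτ.1.measurableSet_eq (m + 1)

theorem lintegral_reward_le (h : Model p P X N) (hs : IsThreshold p s)
    (hτ : Admissible X N hX hN τ) :
    ∫⁻ ω, ENNReal.ofReal (reward X N τ ω) ∂P ≤
      ∫⁻ v, ENNReal.ofReal (stopValue p s v) ∂unif := by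
  rw [h.lintegral_reward_eq_tsum hτ]
  refine ENNReal.tsum_le_of_sum_range_le fun n => ?_
  -- The bound on `gain` starts at time `1`, so the partial sum is extended by one term.
  exact (Finset.sum_le_sum_of_subset (Finset.range_mono n.le_succ)).trans
    (le_self_add.trans (h.gain_succ_le hs hτ n))

/-- The constant `gain` exceeds the partial reward by at most `C P{n+1 ≤ N} = C (1-p)^n`, which
tends to zero. -/
theorem le_lintegral_reward (h : Model p P X N) (hs : IsThreshold p s)
    (hτ : Admissible X N hX hN (firstRelMaxIn X N (lookAheadSet p))) :
    ∫⁻ v, ENNReal.ofReal (stopValue p s v) ∂unif ≤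
      ∫⁻ ω, ENNReal.ofReal (reward X N (firstRelMaxIn X N (lookAheadSet p)) ω) ∂P := by
  obtain ⟨C, hC⟩ := exists_contValue_le h.pos h.lt_one hs.nonneg hs.lt_one.le
  have hbound : ∀ n : ℕ, ∫⁻ v, ENNReal.ofReal (stopValue p s v) ∂unif ≤
      ∫⁻ ω, ENNReal.ofReal (reward X N (firstRelMaxIn X N (lookAheadSet p)) ω) ∂P +
        ENNReal.ofReal C * ENNReal.ofReal (1 - p) ^ n := by
    intro n
    rw [← h.gain_succ_eq hs hτ n, gain, h.lintegral_reward_eq_tsum hτ]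
    refine add_le_add (ENNReal.sum_le_tsum _) ?_
    calc ∫⁻ ω in {ω | ((n + 1 : ℕ) : WithTop ℕ) < firstRelMaxIn X N (lookAheadSet p) ω} ∩
          {ω | n + 1 ≤ N ω}, ENNReal.ofReal (contValue p s (runMax X (n + 1) ω)) ∂P
        ≤ ∫⁻ ω in {ω | n + 1 ≤ N ω}, ENNReal.ofReal (contValue p s (runMax X (n + 1) ω)) ∂P :=
          lintegral_mono_set inter_subset_right
      _ ≤ ∫⁻ ω in {ω | n + 1 ≤ N ω}, ENNReal.ofReal C ∂P := by
          refine lintegral_mono_ae (ae_restrict_of_ae ?_)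
          filter_upwards [h.ae_mem_Icc] with ω hω
          exact ENNReal.ofReal_le_ofReal (hC _ (runMax_mem_Icc hω _).2)
      _ = ENNReal.ofReal C * ENNReal.ofReal (1 - p) ^ n := by
          rw [setLIntegral_const, h.measure_succ_le]
  have hlim : Filter.Tendsto (fun n : ℕ =>
      ∫⁻ ω, ENNReal.ofReal (reward X N (firstRelMaxIn X N (lookAheadSet p)) ω) ∂P +
        ENNReal.ofReal C * ENNReal.ofReal (1 - p) ^ n) Filter.atTop
      (nhds (∫⁻ ω, ENNReal.ofReal (reward X N (firstRelMaxIn X N (lookAheadSet p)) ω) ∂P +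
        ENNReal.ofReal C * 0)) := by
    refine tendsto_const_nhds.add (ENNReal.Tendsto.const_mul
      (ENNReal.tendsto_pow_atTop_nhds_zero_of_lt_one ?_) (Or.inr ENNReal.ofReal_ne_top))
    rw [ENNReal.ofReal_lt_one]
    linarith [h.pos]
  rw [mul_zero, add_zero] at hlim
  exact ge_of_tendsto' hlim hbound

theorem integrable_reward (h : Model p P X N) (hs : IsThreshold p s)
    (hτ : Admissible X N hX hN τ) : Integrable (reward X N τ) P :=
  integrable_of_lintegral_ofReal_lt_top (reward_nonneg τ) (h.measurable_ofReal_reward hτ)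
    ((h.lintegral_reward_le hs hτ).trans_lt (lintegral_stopValue_lt_top h.pos h.lt_one hs))

theorem integral_reward_le (h : Model p P X N) (hs : IsThreshold p s)
    (hτ : Admissible X N hX hN τ)
    (hτ' : Admissible X N hX hN (firstRelMaxIn X N (lookAheadSet p))) :
    ∫ ω, reward X N τ ω ∂P ≤ ∫ ω, reward X N (firstRelMaxIn X N (lookAheadSet p)) ω ∂P := by
  rw [← ENNReal.ofReal_le_ofReal_iff (integral_nonneg (reward_nonneg _)),
    ofReal_integral_eq_lintegral_ofReal (h.integrable_reward hs hτ)
      (Filter.Eventually.of_forall (reward_nonneg _)),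
    ofReal_integral_eq_lintegral_ofReal (h.integrable_reward hs hτ')
      (Filter.Eventually.of_forall (reward_nonneg _))]
  exact (h.lintegral_reward_le hs hτ).trans (h.le_lintegral_reward hs hτ')

end Model

end GeomDuration

/-! ### The main theorem -/

theorem mainTheorem5 :
    (∃! c : ℝ, 1 < c ∧ c ^ 2 * Real.exp (2 / c) = Real.exp 3) ∧
    ∀ c : ℝ, 1 < c → c ^ 2 * Real.exp (2 / c) = Real.exp 3 →
      |c - 3.3145| < 0.0001 ∧
      ∀ (p : ℝ), 0 < p → p < 1 →
      ∀ {Ω : Type*} [MeasurableSpace Ω] (P : Measure Ω) [IsProbabilityMeasure P]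
        (X : ℕ → Ω → ℝ) (N : Ω → ℕ)
        (hX : ∀ k, 1 ≤ k → Measurable (X k)) (hN : Measurable N),
        (∀ k, 1 ≤ k → P.map (X k) = volume.restrict (Set.Icc (0 : ℝ) 1)) →
        iIndepFun (fun k : ℕ => X (k + 1)) P →
        IndepFun (fun ω (k : ℕ) => X (k + 1) ω) N P →
        (∀ k : ℕ, P {ω | N ω = k + 1} = ENNReal.ofReal (p * (1 - p) ^ k)) →
        -- the payoff for stopping at a relative maximum
        (∀ n, 1 ≤ n → Integrable (GeomDuration.duration X N n) P ∧
          ∀ᵐ ω ∂P, n ≤ N ω → GeomDuration.IsRelMax X n ω →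
            (P[GeomDuration.duration X N n | GeomDuration.info X N hX hN n]) ω =
              GeomDuration.payoff p (X n ω)) ∧
        -- the payoff for passing over it and stopping at the next one
        (∀ n, 1 ≤ n →
          Integrable (GeomDuration.reward X N (GeomDuration.nextRelMax X N n)) P ∧
          ∀ᵐ ω ∂P, n ≤ N ω → GeomDuration.IsRelMax X n ω →
            (P[GeomDuration.reward X N (GeomDuration.nextRelMax X N n) |
                GeomDuration.info X N hX hN n]) ω =
              GeomDuration.nextPayoff p (X n ω)) ∧
        -- the one-step-look-ahead rule is optimal
        (GeomDuration.Admissible X N hX hN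
            (GeomDuration.firstRelMaxIn X N (GeomDuration.lookAheadSet p)) ∧
          ∀ τ : Ω → WithTop ℕ, GeomDuration.Admissible X N hX hN τ →
            Integrable (GeomDuration.reward X N τ) P ∧
            ∫ ω, GeomDuration.reward X N τ ω ∂P ≤
              ∫ ω, GeomDuration.reward X N
                (GeomDuration.firstRelMaxIn X N (GeomDuration.lookAheadSet p)) ω ∂P) ∧
        -- it is a threshold rule
        GeomDuration.lookAheadSet p =
          Set.Icc (0 : ℝ) 1 ∩ Set.Ici (GeomDuration.threshold c p) ∧
        (∀ᵐ ω ∂P, GeomDuration.firstRelMaxIn X N (GeomDuration.lookAheadSet p) ω =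
          GeomDuration.firstRelMaxIn X N (Set.Ici (GeomDuration.threshold c p)) ω) ∧
        -- the two ranges of `p`
        (p < 1 / c → 0 < GeomDuration.threshold c p ∧ GeomDuration.threshold c p < 1) ∧
        (1 / c ≤ p → GeomDuration.threshold c p ≤ 0 ∧
          ∀ᵐ ω ∂P, GeomDuration.firstRelMaxIn X N (GeomDuration.lookAheadSet p) ω =
            ((1 : ℕ) : WithTop ℕ)) := by
  refine ⟨GeomDuration.existsUnique_sq_mul_exp, fun c hc hce => ?_⟩
  rw [GeomDuration.sq_mul_exp_eq_iff (by linarith)] at hce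
  refine ⟨GeomDuration.abs_sub_lt_of_log_add_inv hc hce, ?_⟩
  intro p hp0 hp1 Ω _ P _ X N hX hN hmap hindep hindN hgeom
  have h : GeomDuration.Model p P X N := ⟨hp0, hp1, hX, hN, hmap, hindep, hindN, hgeom⟩
  have hs := GeomDuration.isThreshold hp0 hp1 hc hce
  have hB := GeomDuration.lookAheadSet_eq hp0 hp1 hc hce
  have hadm : GeomDuration.Admissible X N hX hN
      (GeomDuration.firstRelMaxIn X N (GeomDuration.lookAheadSet p)) :=
    GeomDuration.Model.admissible_firstRelMaxIn
      (hB ▸ measurableSet_Icc.inter measurableSet_Ici)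
  have hnext := fun n => h.integrable_reward hs
    (GeomDuration.Model.admissible_nextRelMax (X := X) (N := N) (hX := hX) (hN := hN) n)
  refine ⟨fun n hn => ⟨h.integrable_duration hn, h.condExp_duration hn⟩,
    fun n hn => ⟨hnext n, h.condExp_reward_nextRelMax hn (hnext n)⟩,
    ⟨hadm, fun τ hτ => ⟨h.integrable_reward hs hτ, h.integral_reward_le hs hτ hadm⟩⟩, hB, ?_,
    fun hpc => ⟨GeomDuration.threshold_pos hp1 hc hpc,
      GeomDuration.threshold_lt_one hp0 hp1 hc⟩,
    fun hpc => ⟨GeomDuration.threshold_nonpos hp1 hc hpc, ?_⟩⟩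
  · filter_upwards [h.ae_mem_Icc] with ω hω
    refine GeomDuration.firstRelMaxIn_congr fun k hk => ?_
    rw [hB]
    exact and_iff_right (hω k hk)
  · filter_upwards [h.ae_mem_Icc, h.ae_one_le] with ω hω h1
    rw [GeomDuration.firstRelMaxIn_eq_coe_iff]
    refine ⟨⟨le_rfl, h1, fun j hj1 hj2 => ?_, ?_⟩, fun j hj hj' => by omega⟩
    · rw [show j = 1 by omega]
    · rw [hB]
      exact ⟨hω 1 le_rfl, (GeomDuration.threshold_nonpos hp1 hc hpc).trans (hω 1 le_rfl).1⟩
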